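/- Throughout, for $x,y\in\mathbb R^n$ write $x\le y$ if $x_i\le y_i$ for all $i$, and $x\ll y$ (or $y\gg x$) if $x_i<y_i$ for all $i$. **Setting.** Let $U\subset\mathbb R^n$ be open and p-convex (if $x,y\in U$ and $x\le y$, then the segment from $x$ to $y$ lies in $U$), and let $f\in C^2(U\times\mathbb R,\mathbb R^n)$. A *parameter shift* from $\lambda_-$ to $\lambda_+$ (with $\lambda_-<\lambda_+$) is a function $\Lambda\in C^2(\mathbb R,(\lambda_-,\lambda_+))$ with $\lim_{s\to\pm\infty}\Lambda(s)=\lambda_\pm$ and $\lim_{s\to\pm\infty}\Lambda'(s)=0$. Fix such a $\Lambda$ and, for $r>0$, consider the nonautonomous system $\dot x=f(x,\Lambda(rt))$, $x\in U$ (equivalently $\dot x=f(x,\Lambda(s))$, $\dot s=r$). A *path* $(X(s),\Lambda(s))$ is a continuous curve $X:\mathbb R\to U$ with $f(X(s),\Lambda(s))=0$ for all $s$ and with limits $X_\pm=\lim_{s\to\pm\infty}X(s)\in U$. An equilibrium $x$ of $\dot x=f(x,\lambda)$ is *attracting* if all eigenvalues of $D_xf(x,\lambda)$ have negative real part. The path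 is *stable* if $X(s)$ is an attracting equilibrium of $\dot x=f(x,\Lambda(s))$ for every $s\in\mathbb R$. If $X_-$ is an attracting equilibrium for $\lambda_-$, the *pullback attractor* to $X_-$ at rate $r$ is the unique trajectory $x^r(t)$ of $\dot x=f(x,\Lambda(rt))$ in $U$, defined on some maximal interval $(-\infty,T)$ with $T\le\infty$, such that $x^r(t)\to X_-$ as $t\to-\infty$. There is *R-tipping away from $X_-$* for $\Lambda$ at rate $r$ if this pullback attractor exists and is unique and it is not the case that $T=\infty$ and $x^r(t)\to X_+$ as $t\to\infty$. **Proposition.** Suppose that for every $\lambda\in[\lambda_-,\lambda_+]$ the system $\dot x=f(x,\lambda)$ is monotone (cooperative), i.e. $\partial f_i/\partial x_j(x,\lambda)\ge 0$ for all $i\ne j$ and $x\in U$. Let $(p(s),\Lambda(s))$ be a path with limits $p_\pm$, and let $(q(s),\Lambda(s))$ be a stable path with limits $q_\pm$ such that $q_-$ is an attracting equilibrium for $\lambda=\lambda_-$. Suppose that each of the matrices $D_xf(p(s),\Lambda(s))$, $s\in\mathbb R$, and $D_xf(p_\pm,\lambda_\pm)$ has a positive eigenvalue with an eigenvector all of whose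 components are positive. Suppose finally that $q(s)\ll p(s)$ for all $s\in\mathbb R$ and $q_\pm\ll p_\pm$ (resp. $q(s)\gg p(s)$ for all $s\in\mathbb R$ and $q_\pm\gg p_\pm$). 1. If there are $u<v$ with $q(u)\gg p(v)$ (resp. $q(u)\ll p(v)$), then there is a $C^2$ function $\sigma:\mathbb R\to\mathbb R$ with $\sigma'>0$ and $\sigma(s)\to\pm\infty$ as $s\to\pm\infty$ such that $\tilde\Lambda=\Lambda\circ\sigma$ is again a parameter shift from $\lambda_-$ to $\lambda_+$ and there is R-tipping away from $q_-$ for $\tilde\Lambda$ at some rate $r>0$ (that is, the pullback attractor to $q_-$ of $\dot x=f(x,\tilde\Lambda(rt))$ does not converge to $q_+$). 2. If $q_-\gg p_+$ (resp. $q_-\ll p_+$), then there is $r_0>0$ such that for every $r>r_0$ there is R-tipping away from $q_-$ for $\Lambda$ at rate $r$. -/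

import Mathlib

open Set Filter Topology

noncomputable section

namespace RTip

/-- A parameter shift from `lm` to `lp`: a `C²` function with values in `(lm, lp)` that tends to
`lm`, `lp` at `-∞`, `+∞` and whose derivative tends to `0` at both ends. -/
structure IsParameterShift (lm lp : ℝ) (L : ℝ → ℝ) : Prop where
  contDiff : ContDiff ℝ 2 L
  mem_Ioo : ∀ s, L s ∈ Ioo lm lp
  tendsto_atBot : Tendsto L atBot (𝓝 lm)
  tendsto_atTop : Tendsto L atTop (𝓝 lp)
  deriv_atBot : Tendsto (deriv L) atBot (𝓝 0)
  deriv_atTop : Tendsto (deriv L) atTop (𝓝 0)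

/-- An admissible change of time: an increasing `C²` diffeomorphism of the real line. -/
structure IsReparametrization (σ : ℝ → ℝ) : Prop where
  contDiff : ContDiff ℝ 2 σ
  deriv_pos : ∀ s, 0 < deriv σ s
  tendsto_atBot : Tendsto σ atBot atBot
  tendsto_atTop : Tendsto σ atTop atTop

/-- The Jacobian matrix `(∂ gᵢ / ∂ xⱼ)` of a vector field `g` on `ℝⁿ` at `x`. -/
def jacobian {n : ℕ} (g : (Fin n → ℝ) → (Fin n → ℝ)) (x : Fin n → ℝ) :
    Matrix (Fin n) (Fin n) ℝ :=
  Matrix.of fun i j => fderiv ℝ g x (Pi.single j 1) i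

/-- `U` contains the segment between any two of its points that are ordered componentwise. -/
def PConvex {n : ℕ} (U : Set (Fin n → ℝ)) : Prop :=
  ∀ x ∈ U, ∀ y ∈ U, x ≤ y → segment ℝ x y ⊆ U

/-- The system `x' = g x` on `U` is monotone (cooperative): the off-diagonal partial derivatives
are nonnegative. -/
def IsMonotoneSystem {n : ℕ} (U : Set (Fin n → ℝ)) (g : (Fin n → ℝ) → (Fin n → ℝ)) : Prop :=
  ∀ x ∈ U, ∀ i j, i ≠ j → 0 ≤ jacobian g x i j

/-- `x` is an attracting equilibrium of `x' = g x`: all complex eigenvalues of the Jacobian matrix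
have negative real part. -/
def IsAttractingEquilibrium {n : ℕ} (g : (Fin n → ℝ) → (Fin n → ℝ)) (x : Fin n → ℝ) : Prop :=
  g x = 0 ∧ ∀ μ ∈ spectrum ℂ ((jacobian g x).map (algebraMap ℝ ℂ)), μ.re < 0

/-- The Jacobian matrix at `x` has a positive eigenvalue with an eigenvector all of whose
components are positive. -/
def HasPositiveUnstableDirection {n : ℕ} (g : (Fin n → ℝ) → (Fin n → ℝ)) (x : Fin n → ℝ) : Prop :=
  ∃ μ : ℝ, 0 < μ ∧ ∃ v : Fin n → ℝ, StrongLT 0 v ∧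
    Module.End.HasEigenvector (Matrix.toLin' (jacobian g x)) μ v

/-- `(X(s), L(s))` is a path: a continuous curve in `U` of equilibria `X(s)` of
`x' = f(x, L(s))` which has limits `Xm`, `Xp` in `U` at `-∞`, `+∞`. -/
structure IsPath {n : ℕ} (U : Set (Fin n → ℝ)) (f : (Fin n → ℝ) → ℝ → (Fin n → ℝ)) (L : ℝ → ℝ)
    (X : ℝ → (Fin n → ℝ)) (Xm Xp : Fin n → ℝ) : Prop where
  continuous : Continuous X
  mem : ∀ s, X s ∈ U
  equilibrium : ∀ s, f (X s) (L s) = 0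
  limit_mem_left : Xm ∈ U
  limit_mem_right : Xp ∈ U
  tendsto_atBot : Tendsto X atBot (𝓝 Xm)
  tendsto_atTop : Tendsto X atTop (𝓝 Xp)

/-- A stable path: a path of attracting equilibria. -/
structure IsStablePath {n : ℕ} (U : Set (Fin n → ℝ)) (f : (Fin n → ℝ) → ℝ → (Fin n → ℝ))
    (L : ℝ → ℝ) (X : ℝ → (Fin n → ℝ)) (Xm Xp : Fin n → ℝ) : Prop
    extends IsPath U f L X Xm Xp where
  attracting : ∀ s, IsAttractingEquilibrium (fun x => f x (L s)) (X s)

/-- On the open set of times `J`, the curve `x` is a trajectory in `U` of `x' = f(x, L(rt))`,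
and `x(t) → Xm` as `t → -∞`. It is used with `J = (-∞, T)` and `J = ℝ`. -/
structure IsPullbackTrajectory {n : ℕ} (U : Set (Fin n → ℝ)) (f : (Fin n → ℝ) → ℝ → (Fin n → ℝ))
    (L : ℝ → ℝ) (r : ℝ) (Xm : Fin n → ℝ) (J : Set ℝ) (x : ℝ → (Fin n → ℝ)) : Prop where
  mem : ∀ t ∈ J, x t ∈ U
  hasDerivAt : ∀ t ∈ J, HasDerivAt x (f (x t) (L (r * t))) t
  tendsto_atBot : Tendsto x atBot (𝓝 Xm)

/-- The pullback attractor to `Xm` is well defined: a trajectory emanating from `Xm` at time `-∞`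
exists on some half-line `(-∞, T)`, and any two such trajectories coincide where both are defined,
so that all of them are restrictions of one trajectory. -/
def HasPullbackAttractor {n : ℕ} (U : Set (Fin n → ℝ)) (f : (Fin n → ℝ) → ℝ → (Fin n → ℝ))
    (L : ℝ → ℝ) (r : ℝ) (Xm : Fin n → ℝ) : Prop :=
  (∃ (T : ℝ) (x : ℝ → (Fin n → ℝ)), IsPullbackTrajectory U f L r Xm (Iio T) x) ∧
  ∀ (T : ℝ) (x y : ℝ → (Fin n → ℝ)), IsPullbackTrajectory U f L r Xm (Iio T) x →
    IsPullbackTrajectory U f L r Xm (Iio T) y → EqOn x y (Iio T)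

/-- The pullback attractor to `Xm` exists for all times and converges to `Xp` as `t → +∞`. -/
def EndpointTracks {n : ℕ} (U : Set (Fin n → ℝ)) (f : (Fin n → ℝ) → ℝ → (Fin n → ℝ))
    (L : ℝ → ℝ) (r : ℝ) (Xm Xp : Fin n → ℝ) : Prop :=
  ∃ x : ℝ → (Fin n → ℝ), IsPullbackTrajectory U f L r Xm univ x ∧ Tendsto x atTop (𝓝 Xp)

/-- R-tipping away from `Xm` at rate `r`: the pullback attractor to `Xm` is well defined and does
not converge to `Xp` (because it stays away from `Xp` at some arbitrarily late times, or because it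
ceases to exist in `U` in finite time). -/
def RTipping {n : ℕ} (U : Set (Fin n → ℝ)) (f : (Fin n → ℝ) → ℝ → (Fin n → ℝ))
    (L : ℝ → ℝ) (r : ℝ) (Xm Xp : Fin n → ℝ) : Prop :=
  HasPullbackAttractor U f L r Xm ∧ ¬ EndpointTracks U f L r Xm Xp

end RTip

end

/-!
A trajectory of a cooperative system stays strictly above every curve `y` whose components grow
more slowly than the vector field along `y` prescribes, as long as it starts above `y`. Suppose
that `q` lies below `p` at `+∞`. Since `q(s)` is attracting and the Jacobian is a Metzler matrix,
all components of the vector field are positive at points slightly below `q(s)` in a suitable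
negative direction; they are also positive at points slightly displaced from `p(s)` along the
unstable direction. Traversed slowly, the two curves of displaced points satisfy the growth
condition, and both can be chosen constant near `±∞`.

The pullback attractor to `q₋` starts above the displaced copy of `q`. If the parameter moves from
`u` to `v` within a short time, then the attractor hardly loses height, so after the jump it lies
above the displaced copy of `p`, and it remains there. A fast parameter shift has the same effect
with `u`, `v` replaced by `-∞`, `+∞`. The pullback attractor exists because the trajectory is a
fixed point of an integral equation with damping, which the Metzler structure turns into a
contraction. The case of the opposite order follows by the reflection `x ↦ -x`.
-/

namespace RTip

section Metzler

open scoped Matrix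

variable {ι : Type*}

/-- Metzler matrices: the off-diagonal entries are nonnegative. A system is cooperative when all
its Jacobian matrices are of this kind. -/
def IsMetzler (A : Matrix ι ι ℝ) : Prop :=
  ∀ i j, i ≠ j → 0 ≤ A i j

lemma exists_first_contact [Finite ι] {x y : ℝ → ι → ℝ} {a b t : ℝ}
    (hx : ContinuousOn x (Icc a b)) (hy : ContinuousOn y (Icc a b)) (ha : StrongLT (y a) (x a))
    (ht : t ∈ Icc a b) (hyx : ¬ StrongLT (y t) (x t)) :
    ∃ τ ∈ Ioc a b, (∀ s ∈ Ico a τ, StrongLT (y s) (x s)) ∧ y τ ≤ x τ ∧ ∃ i, y τ i = x τ i := by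
  set S : Set ℝ := ⋃ i, {t ∈ Icc a b | x t i ≤ y t i}
  have hS_compact : IsCompact S := isCompact_iUnion fun i =>
    isCompact_Icc.of_isClosed_subset (isClosed_Icc.isClosed_le (continuousOn_pi.1 hx i)
      (continuousOn_pi.1 hy i)) (sep_subset _ _)
  have hS_nonempty : S.Nonempty := by
    simp only [StrongLT, not_forall, not_lt] at hyx
    obtain ⟨i, hi⟩ := hyx
    exact ⟨t, mem_iUnion.2 ⟨i, ht, hi⟩⟩
  obtain ⟨τ, hτS, hτ_least⟩ := hS_compact.exists_isLeast hS_nonempty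
  obtain ⟨i, hτ, hi⟩ := mem_iUnion.1 hτS
  have before (s) (hs : s ∈ Ico a τ) : StrongLT (y s) (x s) := fun j => by
    by_contra! hj
    exact (hτ_least (mem_iUnion.2 ⟨j, ⟨hs.1, hs.2.le.trans hτ.2⟩, hj⟩)).not_gt hs.2
  have haτ : a < τ := hτ.1.lt_of_ne fun h => (ha i).not_ge (h ▸ hi)
  have hsub : Ico a τ ⊆ Icc a b := fun s hs => ⟨hs.1, hs.2.le.trans hτ.2⟩
  have hτ_closure : τ ∈ closure (Ico a τ) := by
    rw [closure_Ico haτ.ne]; exact right_mem_Icc.2 haτ.le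
  have hle : y τ ≤ x τ := fun j =>
    ContinuousWithinAt.closure_le (f := fun s => y s j) (g := fun s => x s j) hτ_closure
      ((continuousOn_pi.1 hy j τ hτ).mono hsub) ((continuousOn_pi.1 hx j τ hτ).mono hsub)
      fun s hs => (before s hs j).le
  exact ⟨τ, ⟨haτ, hτ.2⟩, before, hle, i, (hle i).antisymm hi⟩

variable [Fintype ι] {A : Matrix ι ι ℝ} {v w : ι → ℝ}

lemma IsMetzler.sum_mul_le_mulVec_apply (hA : IsMetzler A) {i : ι} (hi : ∀ j, v i ≤ v j) :
    (∑ j, A i j) * v i ≤ (A *ᵥ v) i := by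
  rw [Matrix.mulVec, dotProduct, Finset.sum_mul]
  refine Finset.sum_le_sum fun j _ => ?_
  rcases eq_or_ne i j with rfl | hij
  · rfl
  · exact mul_le_mul_of_nonneg_left (hi j) (hA i j hij)

lemma IsMetzler.strongLT_of_nonneg (hA : IsMetzler A) {t : ℝ} (hv : 0 ≤ v)
    (hAv : ∀ i, (A *ᵥ v) i < t * v i) : StrongLT 0 v := fun i => by
  refine (hv i).lt_of_ne fun (hi : 0 = v i) => ?_
  have hmin : (∑ j, A i j) * v i ≤ (A *ᵥ v) i := hA.sum_mul_le_mulVec_apply fun j => hi ▸ hv j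
  have hAvi := hAv i
  rw [← hi, mul_zero] at hmin hAvi
  exact hmin.not_gt hAvi

lemma IsMetzler.nonneg_of_sum_le (hA : IsMetzler A) {t : ℝ} (hsum : ∀ i, ∑ j, A i j ≤ t)
    (hAv : ∀ i, (A *ᵥ v) i < t * v i) : 0 ≤ v := by
  by_contra hv
  obtain ⟨k, hk⟩ : ∃ k, v k < 0 := by simpa [Pi.le_def] using hv
  obtain ⟨i, -, hi⟩ := Finset.exists_min_image Finset.univ v ⟨k, Finset.mem_univ k⟩
  have hvi : v i < 0 := (hi k (Finset.mem_univ k)).trans_lt hk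
  have hmin := hA.sum_mul_le_mulVec_apply fun j => hi j (Finset.mem_univ j)
  have := mul_le_mul_of_nonpos_right (hsum i) hvi.le
  linarith [hAv i]

lemma exists_damping_of_mulVec_neg (hAw : StrongLT (A *ᵥ w) 0) :
    ∃ K k : ℝ, 0 ≤ k ∧ k < K ∧ ∀ i, 0 ≤ K + A i i ∧ K * w i + (A *ᵥ w) i ≤ k * w i := by
  obtain ⟨c, hc, hc0⟩ : ∃ c, (∀ i, (A *ᵥ w) i ≤ -c * w i) ∧ 0 < c := by
    have hsmall : ∀ᶠ c in 𝓝 (0 : ℝ), ∀ i, (A *ᵥ w) i < -c * w i :=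
      eventually_all.2 fun i =>
        continuousAt_const.eventually_lt (by fun_prop) (by simpa using hAw i)
    obtain ⟨c, hc0, hc⟩ := hsmall.exists_gt
    exact ⟨c, fun i => (hc i).le, hc0⟩
  obtain ⟨K, hK⟩ := Finite.exists_le fun i => -A i i
  refine ⟨max K c, max K c - c, sub_nonneg.2 (le_max_right K c), sub_lt_self _ hc0,
    fun i => ⟨?_, ?_⟩⟩
  · linarith [hK i, le_max_left K c]
  · linarith [hc i]

lemma IsMetzler.norm_smul_add_mulVec_div_le (hA : IsMetzler A) (hw : StrongLT 0 w) {K k : ℝ}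
    (hk : 0 ≤ k) (hdiag : ∀ i, 0 ≤ K + A i i) (hAw : ∀ i, K * w i + (A *ᵥ w) i ≤ k * w i) :
    ‖K • v + A *ᵥ (w * v) / w‖ ≤ k * ‖v‖ := by
  classical
  set B : Matrix ι ι ℝ := K • 1 + A with hB
  have hB_nonneg (i j) : 0 ≤ B i j := by
    rcases eq_or_ne i j with rfl | hij
    · simpa [hB] using hdiag i
    · simpa [hB, hij] using hA i j hij
  have hB_mulVec (u : ι → ℝ) (i) : (B *ᵥ u) i = K * u i + (A *ᵥ u) i := by
    simp [hB, Matrix.add_mulVec, Matrix.smul_mulVec]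
  refine (pi_norm_le_iff_of_nonneg (by positivity)).2 fun i => ?_
  have hwi : 0 < w i := hw i
  have hquot : (K • v + A *ᵥ (w * v) / w) i = (B *ᵥ (w * v)) i / w i := by
    rw [hB_mulVec]
    simp only [Pi.add_apply, Pi.smul_apply, smul_eq_mul, Pi.div_apply, Pi.mul_apply]
    field_simp
  rw [hquot, norm_div, Real.norm_of_nonneg hwi.le, div_le_iff₀ hwi]
  calc ‖(B *ᵥ (w * v)) i‖
      ≤ ∑ j, ‖B i j * (w * v) j‖ := norm_sum_le _ _
    _ ≤ ∑ j, B i j * w j * ‖v‖ := by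
        gcongr with j
        rw [Pi.mul_apply, ← mul_assoc, norm_mul,
          Real.norm_of_nonneg (mul_nonneg (hB_nonneg i j) (hw j).le)]
        exact mul_le_mul_of_nonneg_left (norm_le_pi_norm v j)
          (mul_nonneg (hB_nonneg i j) (hw j).le)
    _ = (B *ᵥ w) i * ‖v‖ := by rw [← Finset.sum_mul]; rfl
    _ ≤ k * w i * ‖v‖ := by
        rw [hB_mulVec]
        exact mul_le_mul_of_nonneg_right (hAw i) (norm_nonneg v)
    _ = k * ‖v‖ * w i := by ring

variable [DecidableEq ι]

lemma det_smul_one_sub_ne_zero (hA : ∀ μ ∈ spectrum ℂ (A.map (algebraMap ℝ ℂ)), μ.re < 0)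
    {t : ℝ} (ht : 0 ≤ t) : (t • (1 : Matrix ι ι ℝ) - A).det ≠ 0 := fun h0 => by
  have hmap : algebraMap ℂ (Matrix ι ι ℂ) t - A.map (algebraMap ℝ ℂ)
      = (algebraMap ℝ ℂ).mapMatrix (t • (1 : Matrix ι ι ℝ) - A) := by
    ext i j
    by_cases hij : i = j <;> simp [Matrix.algebraMap_matrix_apply, hij]
  have hmem : (t : ℂ) ∈ spectrum ℂ (A.map (algebraMap ℝ ℂ)) := by
    rw [spectrum.mem_iff, hmap, Matrix.isUnit_iff_isUnit_det, ← RingHom.map_det, h0, map_zero]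
    exact not_isUnit_zero
  exact ht.not_gt (by simpa using hA _ hmem)

lemma continuousOn_inv_mulVec {X : Type*} [TopologicalSpace X] {B : X → Matrix ι ι ℝ} {s : Set X}
    (hB : Continuous B) (hs : ∀ t ∈ s, (B t).det ≠ 0) (v : ι → ℝ) :
    ContinuousOn (fun t => (B t)⁻¹ *ᵥ v) s := by
  simp only [Matrix.inv_def, Ring.inverse_eq_inv', Matrix.smul_mulVec]
  exact (hB.matrix_det.continuousOn.inv₀ hs).smul
    (hB.matrix_adjugate.matrix_mulVec continuous_const).continuousOn

theorem IsMetzler.exists_pos_mulVec_neg (hA : IsMetzler A)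
    (hspec : ∀ μ ∈ spectrum ℂ (A.map (algebraMap ℝ ℂ)), μ.re < 0) :
    ∃ w : ι → ℝ, StrongLT 0 w ∧ StrongLT (A *ᵥ w) 0 := by
  -- `V t = (t - A)⁻¹ 1` is positive for large `t` and stays so down to `t = 0`: it satisfies
  -- `A V < t V`, hence cannot touch the boundary of the positive cone.
  set V : ℝ → ι → ℝ := fun t => (t • (1 : Matrix ι ι ℝ) - A)⁻¹ *ᵥ 1 with hV
  have hdet (t : ℝ) (ht : t ∈ Ici 0) : (t • (1 : Matrix ι ι ℝ) - A).det ≠ 0 :=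
    det_smul_one_sub_ne_zero hspec ht
  have hV_cont : ContinuousOn V (Ici 0) := continuousOn_inv_mulVec (by fun_prop) hdet 1
  have hV_eq (t : ℝ) (ht : 0 ≤ t) (i : ι) : (A *ᵥ V t) i = t * V t i - 1 := by
    have hsolve : (t • (1 : Matrix ι ι ℝ) - A) *ᵥ V t = 1 := by
      rw [hV, Matrix.mulVec_mulVec, Matrix.mul_nonsing_inv _ (hdet t ht).isUnit, Matrix.one_mulVec]
    have := congrFun hsolve i
    simp only [Matrix.sub_mulVec, Matrix.smul_mulVec, Matrix.one_mulVec, Pi.sub_apply,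
      Pi.smul_apply, smul_eq_mul, Pi.one_apply] at this
    linarith
  have hV_lt (t : ℝ) (ht : 0 ≤ t) (i : ι) : (A *ᵥ V t) i < t * V t i := by
    rw [hV_eq t ht]; exact sub_one_lt _
  obtain ⟨R, hR⟩ := Finite.exists_le fun i => ∑ j, A i j
  set S := max R 0
  have hS : 0 ≤ S := le_max_right R 0
  have hV_S : StrongLT 0 (V S) := hA.strongLT_of_nonneg
    (hA.nonneg_of_sum_le (fun i => (hR i).trans (le_max_left R 0)) (hV_lt S hS)) (hV_lt S hS)
  have hV_zero : StrongLT 0 (V 0) := by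
    by_contra hneg
    obtain ⟨τ, hτ, -, hle, i, hi⟩ := exists_first_contact (x := fun s => V (S - s))
      (y := fun _ => 0) (a := 0) (b := S) (t := S)
      (hV_cont.comp (by fun_prop) fun s hs => sub_nonneg.2 hs.2) continuousOn_const
      (by simpa using hV_S) (right_mem_Icc.2 hS) (by simpa using hneg)
    exact (hA.strongLT_of_nonneg hle (hV_lt _ (sub_nonneg.2 hτ.2)) i).ne hi
  exact ⟨V 0, hV_zero, fun i => by rw [hV_eq 0 le_rfl i]; simp⟩

end Metzler

section Jacobian

open scoped Matrix

variable {n : ℕ} {U : Set (Fin n → ℝ)} {f : (Fin n → ℝ) → ℝ → (Fin n → ℝ)} {x y : Fin n → ℝ}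

lemma jacobian_mulVec (g : (Fin n → ℝ) → (Fin n → ℝ)) (x v : Fin n → ℝ) :
    jacobian g x *ᵥ v = fderiv ℝ g x v := by
  ext i
  conv_rhs => rw [pi_eq_sum_univ' v]
  rw [Matrix.mulVec_eq_sum]
  simp [jacobian, map_sum]

lemma contDiffAt_uncurry (hU : IsOpen U) (hf : ContDiffOn ℝ 1 (Function.uncurry f) (U ×ˢ univ))
    (hx : x ∈ U) (l : ℝ) : ContDiffAt ℝ 1 (Function.uncurry f) (x, l) :=
  hf.contDiffAt ((hU.prod isOpen_univ).mem_nhds ⟨hx, mem_univ l⟩)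

lemma differentiableAt_section (hU : IsOpen U)
    (hf : ContDiffOn ℝ 1 (Function.uncurry f) (U ×ˢ univ)) (hx : x ∈ U) (l : ℝ) :
    DifferentiableAt ℝ (fun x => f x l) x :=
  ((contDiffAt_uncurry hU hf hx l).comp x
    (contDiffAt_id.prodMk contDiffAt_const)).differentiableAt one_ne_zero

lemma continuousAt_jacobian (hU : IsOpen U)
    (hf : ContDiffOn ℝ 1 (Function.uncurry f) (U ×ˢ univ)) (hx : x ∈ U) (l : ℝ) :
    ContinuousAt (fun z : (Fin n → ℝ) × ℝ => jacobian (fun x => f x z.2) z.1) (x, l) := by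
  have hderiv : ContinuousAt (fun z : (Fin n → ℝ) × ℝ => fderiv ℝ (fun x => f x z.2) z.1) (x, l) :=
    (ContDiffAt.fderiv (n := 1) (m := 0) (f := fun (z : (Fin n → ℝ) × ℝ) x => f x z.2)
      ((contDiffAt_uncurry hU hf hx l).comp ((x, l), x)
        (contDiffAt_snd.prodMk contDiffAt_fst.snd)) contDiffAt_fst (by norm_num)).continuousAt
  refine continuousAt_pi.2 fun i => continuousAt_pi.2 fun j => ?_
  exact (continuous_apply i).continuousAt.comp (hderiv.clm_apply continuousAt_const)

lemma exists_sub_apply_eq_jacobian_mulVec {g : (Fin n → ℝ) → (Fin n → ℝ)}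
    (hg : ∀ z ∈ segment ℝ x y, DifferentiableAt ℝ g z) (i : Fin n) :
    ∃ z ∈ segment ℝ x y, g y i - g x i = (jacobian g z *ᵥ (y - x)) i := by
  obtain ⟨z, hz, h⟩ := domain_mvt
    (fun z hz => (hasFDerivAt_pi'.1 (hg z hz).hasFDerivAt i).hasFDerivWithinAt)
    (convex_segment x y) (left_mem_segment ℝ x y) (right_mem_segment ℝ x y)
  exact ⟨z, hz, by rw [h, jacobian_mulVec]; rfl⟩

end Jacobian

section Comparison

variable {n : ℕ} {U : Set (Fin n → ℝ)} {f : (Fin n → ℝ) → ℝ → (Fin n → ℝ)} {I : Set ℝ}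

/-- The standing assumptions of the comparison arguments: the systems `x' = f(x, λ)`, `λ ∈ I`, are
cooperative on the open p-convex set `U`, and `f` is continuously differentiable. -/
structure IsCooperativeFamily (U : Set (Fin n → ℝ)) (f : (Fin n → ℝ) → ℝ → (Fin n → ℝ))
    (I : Set ℝ) : Prop where
  isOpen : IsOpen U
  pconvex : PConvex U
  contDiffOn : ContDiffOn ℝ 1 (Function.uncurry f) (U ×ˢ univ)
  monotone : ∀ l ∈ I, IsMonotoneSystem U fun x => f x l

lemma IsCooperativeFamily.apply_le_apply (hf : IsCooperativeFamily U f I) {l : ℝ} (hl : l ∈ I)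
    {x y : Fin n → ℝ} (hx : x ∈ U) (hy : y ∈ U) (hxy : x ≤ y) {i : Fin n} (hi : x i = y i) :
    f x l i ≤ f y l i := by
  have hsub : segment ℝ x y ⊆ U := hf.pconvex x hx y hy hxy
  obtain ⟨z, hz, hz_eq⟩ := exists_sub_apply_eq_jacobian_mulVec
    (fun z hz => differentiableAt_section hf.isOpen hf.contDiffOn (hsub hz) l) i
  have hmetzler : IsMetzler (jacobian (fun x => f x l) z) := hf.monotone l hl z (hsub hz)
  have hmin := hmetzler.sum_mul_le_mulVec_apply (v := y - x) (i := i) fun j => by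
    simpa [hi] using hxy j
  rw [← hz_eq] at hmin
  simp only [Pi.sub_apply, hi, sub_self, mul_zero] at hmin
  exact sub_nonneg.1 hmin

/-- On the set of times `J`, the curve `y` is a strict lower solution of `x' = f(x, l(t))`: its
components grow at most at a rate `κ` that is smaller than every component of the vector field
along `y`. Growth is expressed by increments because the curves `y` used below are only
Lipschitz. -/
structure IsStrictLowerSolution (U : Set (Fin n → ℝ)) (f : (Fin n → ℝ) → ℝ → (Fin n → ℝ))
    (l : ℝ → ℝ) (J : Set ℝ) (κ : ℝ) (y : ℝ → (Fin n → ℝ)) : Prop where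
  continuousOn : ContinuousOn y J
  mem : ∀ t ∈ J, y t ∈ U
  growth : ∀ s ∈ J, ∀ t ∈ J, s ≤ t → ∀ i, y t i - y s i ≤ κ * (t - s)
  lt_field : ∀ t ∈ J, ∀ i, κ < f (y t) (l t) i

variable {l : ℝ → ℝ} {J : Set ℝ} {κ : ℝ} {x y : ℝ → (Fin n → ℝ)}

lemma IsStrictLowerSolution.mono {J' : Set ℝ} (h : IsStrictLowerSolution U f l J κ y)
    (hJ : J' ⊆ J) : IsStrictLowerSolution U f l J' κ y :=
  ⟨h.continuousOn.mono hJ, fun t ht => h.mem t (hJ ht),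
    fun s hs t ht => h.growth s (hJ hs) t (hJ ht), fun t ht => h.lt_field t (hJ ht)⟩

lemma deriv_le_of_contact {x y : ℝ → ℝ} {a τ d : ℝ} (haτ : a < τ) (hx : HasDerivAt x d τ)
    (hτ : y τ = x τ) (hle : ∀ s ∈ Ico a τ, y s ≤ x s)
    (hy : ∀ s ∈ Ico a τ, y τ - y s ≤ κ * (τ - s)) : d ≤ κ := by
  have hslope : Tendsto (slope x τ) (𝓝[<] τ) (𝓝 d) :=
    (hasDerivAt_iff_tendsto_slope.1 hx).mono_left (nhdsLT_le_nhdsNE τ)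
  refine le_of_tendsto hslope ?_
  filter_upwards [Ico_mem_nhdsLT haτ] with s hs
  rw [slope_def_field, div_le_iff_of_neg (sub_neg.2 hs.2)]
  linarith [hle s hs, hy s hs]

theorem IsStrictLowerSolution.strongLT {a b : ℝ} (hf : IsCooperativeFamily U f I)
    (hl : ∀ t ∈ Icc a b, l t ∈ I) (hy : IsStrictLowerSolution U f l (Icc a b) κ y)
    (hxU : ∀ t ∈ Icc a b, x t ∈ U) (hx : ∀ t ∈ Icc a b, HasDerivAt x (f (x t) (l t)) t)
    (ha : StrongLT (y a) (x a)) : ∀ t ∈ Icc a b, StrongLT (y t) (x t) := by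
  intro t ht
  by_contra hyx
  obtain ⟨τ, hτ, before, hle, i, hi⟩ := exists_first_contact
    (fun t ht => (hx t ht).continuousAt.continuousWithinAt) hy.continuousOn ha ht hyx
  have hτ' : τ ∈ Icc a b := Ioc_subset_Icc_self hτ
  have hfield_le : f (x τ) (l τ) i ≤ κ :=
    deriv_le_of_contact (y := fun s => y s i) hτ.1 (hasDerivAt_pi.1 (hx τ hτ') i) hi
      (fun s hs => (before s hs i).le)
      fun s hs => hy.growth s ⟨hs.1, hs.2.le.trans hτ.2⟩ τ hτ' hs.2.le i
  have hkamke : f (y τ) (l τ) i ≤ f (x τ) (l τ) i :=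
    hf.apply_le_apply (hl τ hτ') (hy.mem τ hτ') (hxU τ hτ') hle hi
  exact (hy.lt_field τ hτ' i).not_ge (hkamke.trans hfield_le)

end Comparison

section DampedEquation

variable {E : Type*} [NormedAddCommGroup E] [NormedSpace ℝ E] {K k R T : ℝ} {D g : ℝ → E}

lemma hasDerivAt_exp_mul_sub (K a t : ℝ) :
    HasDerivAt (fun t => Real.exp (K * (t - a))) (Real.exp (K * (t - a)) * K) t := by
  simpa using (((hasDerivAt_id t).sub_const a).const_mul K).exp

lemma norm_le_exp_mul_norm_add_of_damped (hK : K ≠ 0) {s t : ℝ} (hst : s ≤ t)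
    (hD : ∀ τ ∈ Icc s t, HasDerivAt D (-(K • D τ) + g τ) τ) (hg : ∀ τ ∈ Icc s t, ‖g τ‖ ≤ R) :
    ‖D t‖ ≤ Real.exp (K * (s - t)) * ‖D s‖ + R / K * (1 - Real.exp (K * (s - t))) := by
  set e : ℝ → ℝ := fun τ => Real.exp (K * (τ - t)) with he
  have hnorm (τ : ℝ) (x : E) : ‖e τ • x‖ = e τ * ‖x‖ := by
    rw [norm_smul, Real.norm_of_nonneg (Real.exp_pos _).le]
  have hderiv (τ : ℝ) (hτ : τ ∈ Icc s t) : HasDerivAt (fun τ => e τ • D τ) (e τ • g τ) τ :=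
    ((hasDerivAt_exp_mul_sub K t τ).smul (hD τ hτ)).congr_deriv (by module)
  have hbound : ‖e t • D t‖ ≤ e s * ‖D s‖ + R / K * (e t - e s) :=
    image_norm_le_of_norm_deriv_right_le_deriv_boundary (f := fun τ => e τ • D τ)
      (B := fun τ => e s * ‖D s‖ + R / K * (e τ - e s)) (B' := fun τ => R / K * (e τ * K))
      (fun τ hτ => (hderiv τ hτ).continuousAt.continuousWithinAt)
      (fun τ hτ => (hderiv τ (Ico_subset_Icc_self hτ)).hasDerivWithinAt)
      (by rw [hnorm, sub_self, mul_zero, add_zero])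
      (fun τ => (((hasDerivAt_exp_mul_sub K t τ).sub_const _).const_mul _).const_add _)
      (fun τ hτ => by
        calc ‖e τ • g τ‖ = e τ * ‖g τ‖ := hnorm τ (g τ)
          _ ≤ e τ * R := mul_le_mul_of_nonneg_left (hg τ (Ico_subset_Icc_self hτ))
              (Real.exp_pos _).le
          _ = R / K * (e τ * K) := by field_simp)
      (right_mem_Icc.2 hst)
  simpa [he] using hbound

lemma norm_le_div_of_damped (hK : 0 < K) (hD : ∀ t < T, HasDerivAt D (-(K • D t) + g t) t)
    (hg : ∀ t < T, ‖g t‖ ≤ R) {M : ℝ} (hM : ∀ t < T, ‖D t‖ ≤ M) {t : ℝ} (ht : t < T) :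
    ‖D t‖ ≤ R / K := by
  have hlim : Tendsto (fun s => Real.exp (K * (s - t))) atBot (𝓝 0) :=
    Real.tendsto_exp_atBot.comp
      ((tendsto_atBot_add_const_right atBot (-t) tendsto_id).const_mul_atBot hK)
  have hbound : ∀ᶠ s in atBot, ‖D t‖ ≤
      Real.exp (K * (s - t)) * M + R / K * (1 - Real.exp (K * (s - t))) := by
    filter_upwards [Iic_mem_atBot t] with s hs
    refine (norm_le_exp_mul_norm_add_of_damped hK.ne' hs (fun τ hτ => hD τ (hτ.2.trans_lt ht))
      fun τ hτ => hg τ (hτ.2.trans_lt ht)).trans ?_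
    gcongr
    exact hM s (lt_of_le_of_lt hs ht)
  simpa using ge_of_tendsto ((hlim.mul_const M).add ((hlim.const_sub 1).const_mul (R / K))) hbound

lemma norm_le_div_sub_of_damped (hk : 0 ≤ k) (hkK : k < K) {H M : ℝ}
    (hD : ∀ t < T, HasDerivAt D (-(K • D t) + g t) t) (hg : ∀ t < T, ‖g t‖ ≤ H + k * ‖D t‖)
    (hM : ∀ t < T, ‖D t‖ ≤ M) {t : ℝ} (ht : t < T) : ‖D t‖ ≤ H / (K - k) := by
  have hK : 0 < K := hk.trans_lt hkK
  set N := sSup ((fun t => ‖D t‖) '' Iio T)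
  have hle (s : ℝ) (hs : s < T) : ‖D s‖ ≤ N :=
    le_csSup ⟨M, forall_mem_image.2 hM⟩ (mem_image_of_mem _ hs)
  have hN : N ≤ (H + k * N) / K := by
    refine csSup_le ⟨_, mem_image_of_mem _ ht⟩ (forall_mem_image.2 fun s hs => ?_)
    refine norm_le_div_of_damped hK hD (fun τ hτ => (hg τ hτ).trans ?_) hle hs
    gcongr
    exact hle τ hτ
  rw [le_div_iff₀ hK] at hN
  refine (hle t ht).trans ((le_div_iff₀ (sub_pos.2 hkK)).2 ?_)
  linarith

lemma tendsto_zero_of_damped (hk : 0 ≤ k) (hkK : k < K) {M : ℝ} {h : ℝ → ℝ}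
    (hD : ∀ t < T, HasDerivAt D (-(K • D t) + g t) t) (hg : ∀ t < T, ‖g t‖ ≤ h t + k * ‖D t‖)
    (hM : ∀ t < T, ‖D t‖ ≤ M) (hh : Tendsto h atBot (𝓝 0)) : Tendsto D atBot (𝓝 0) := by
  refine Metric.nhds_basis_closedBall.tendsto_right_iff.2 fun ε hε => ?_
  have hε' : 0 < (K - k) * ε := mul_pos (sub_pos.2 hkK) hε
  obtain ⟨S, hS⟩ := eventually_atBot.1 ((hh.eventually_lt_const hε').and (Iio_mem_atBot T))
  filter_upwards [Iio_mem_atBot S] with t ht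
  have hlt (s : ℝ) (hs : s < S) : s < T := (hS s hs.le).2
  have hbound : ‖D t‖ ≤ (K - k) * ε / (K - k) :=
    norm_le_div_sub_of_damped hk hkK (fun s hs => hD s (hlt s hs))
      (fun s hs => (hg s (hlt s hs)).trans (by gcongr; exact (hS s hs.le).1.le))
      (fun s hs => hM s (hlt s hs)) ht
  rwa [mem_closedBall_zero_iff, ← mul_div_cancel_left₀ ε (sub_pos.2 hkK).ne']

variable [CompleteSpace E]

lemma hasDerivAt_integral_Iic {F : ℝ → E} (hF : Continuous F)
    (hint : ∀ t, MeasureTheory.IntegrableOn F (Iic t)) (t : ℝ) :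
    HasDerivAt (fun t => ∫ s in Iic t, F s) (F t) t := by
  have hsplit : (fun t => ∫ s in Iic t, F s) =
      fun t => (∫ s in Iic 0, F s) + ∫ s in (0 : ℝ)..t, F s := by
    ext t
    rw [← intervalIntegral.integral_Iic_sub_Iic (hint 0) (hint t), add_sub_cancel]
  rw [hsplit]
  exact (intervalIntegral.integral_hasDerivAt_right (hF.intervalIntegrable 0 t)
    (hF.stronglyMeasurableAtFilter _ _) hF.continuousAt).const_add _

lemma exists_bounded_solution_of_damped (hK : 0 < K) (hg : Continuous g) (hR : ∀ t, ‖g t‖ ≤ R) :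
    ∃ D : ℝ → E, (∀ t, HasDerivAt D (-(K • D t) + g t) t) ∧ ∀ t, ‖D t‖ ≤ R / K := by
  -- variation of constants: `D t = ∫_{-∞}^t e^{-K(t-s)} g s ds`
  have hbound (s : ℝ) : ‖Real.exp (K * s) • g s‖ ≤ Real.exp (K * s) * R := by
    rw [norm_smul, Real.norm_of_nonneg (Real.exp_pos _).le]
    exact mul_le_mul_of_nonneg_left (hR s) (Real.exp_pos _).le
  have hint (t : ℝ) : MeasureTheory.IntegrableOn (fun s => Real.exp (K * s) * R) (Iic t) :=
    (integrableOn_exp_mul_Iic hK t).mul_const R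
  have hcont : Continuous fun s => Real.exp (K * s) • g s := by fun_prop
  have hderiv := hasDerivAt_integral_Iic hcont fun t =>
    (hint t).mono' hcont.aestronglyMeasurable (Eventually.of_forall hbound)
  refine ⟨fun t => Real.exp (-(K * t)) • ∫ s in Iic t, Real.exp (K * s) • g s, fun t => ?_,
    fun t => ?_⟩
  · have hexp : HasDerivAt (fun t => Real.exp (-(K * t))) (Real.exp (-(K * t)) * -K) t := by
      simpa using (((hasDerivAt_id t).const_mul K).neg).exp
    refine (hexp.smul (hderiv t)).congr_deriv ?_
    rw [smul_smul (Real.exp (-(K * t))), ← Real.exp_add, neg_add_cancel, Real.exp_zero]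
    module
  · rw [norm_smul, Real.norm_of_nonneg (Real.exp_pos _).le]
    calc Real.exp (-(K * t)) * ‖∫ s in Iic t, Real.exp (K * s) • g s‖
        ≤ Real.exp (-(K * t)) * ∫ s in Iic t, Real.exp (K * s) * R := by
          gcongr
          exact MeasureTheory.norm_integral_le_of_norm_le (hint t) (Eventually.of_forall hbound)
      _ = Real.exp (-(K * t)) * Real.exp (K * t) * (R / K) := by
          rw [MeasureTheory.integral_mul_const, integral_exp_mul_Iic hK]; ring
      _ = R / K := by rw [← Real.exp_add, neg_add_cancel, Real.exp_zero, one_mul]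

open scoped BoundedContinuousFunction

lemma exists_solution_in_closedBall_of_damped {ρ : ℝ} (hK : 0 < K) (hρ : 0 ≤ ρ) (hg : Continuous g)
    (hg_le : ∀ t, ‖g t‖ ≤ K * ρ) : ∃ D : ℝ →ᵇ Metric.closedBall (0 : E) ρ,
      ∀ t, HasDerivAt (fun t => (D t : E)) (-(K • (D t : E)) + g t) t := by
  obtain ⟨D, hD, hD_le⟩ := exists_bounded_solution_of_damped hK hg hg_le
  rw [mul_div_cancel_left₀ ρ hK.ne'] at hD_le
  have hD_cont : Continuous D := continuous_iff_continuousAt.2 fun t => (hD t).continuousAt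
  exact ⟨.mkOfBound ⟨fun t => ⟨D t, mem_closedBall_zero_iff.2 (hD_le t)⟩, by fun_prop⟩ (2 * ρ)
    fun s t => (Metric.dist_le_diam_of_mem Metric.isBounded_closedBall (Subtype.prop _)
      (Subtype.prop _)).trans (Metric.diam_closedBall hρ), hD⟩

theorem exists_solution_in_closedBall_of_lipschitz {ρ : ℝ} (hk : 0 ≤ k) (hkK : k < K)
    {G : ℝ → E → E} (hG : ContinuousOn (Function.uncurry G) (univ ×ˢ Metric.closedBall 0 ρ))
    (hlip : ∀ t, ∀ y ∈ Metric.closedBall 0 ρ, ∀ z ∈ Metric.closedBall 0 ρ,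
      ‖G t y - G t z‖ ≤ k * ‖y - z‖)
    (hzero : ∀ t, ‖G t 0‖ ≤ (K - k) * ρ) :
    ∃ y : ℝ → E, (∀ t, ‖y t‖ ≤ ρ) ∧ ∀ t, HasDerivAt y (-(K • y t) + G t (y t)) t := by
  have hK : 0 < K := hk.trans_lt hkK
  have hρ : 0 ≤ ρ :=
    nonneg_of_mul_nonneg_right ((norm_nonneg _).trans (hzero 0)) (sub_pos.2 hkK)
  have hG_le (y : ℝ →ᵇ Metric.closedBall (0 : E) ρ) (t : ℝ) : ‖G t (y t)‖ ≤ K * ρ := by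
    have hy : ‖(y t : E)‖ ≤ ρ := mem_closedBall_zero_iff.1 (y t).2
    have hdiff := hlip t (y t) (y t).2 0 (Metric.mem_closedBall_self hρ)
    rw [sub_zero] at hdiff
    have hky := mul_le_mul_of_nonneg_left hy hk
    linarith [norm_le_norm_add_norm_sub' (G t (y t)) (G t 0), hzero t]
  have hdist (y z : ℝ →ᵇ Metric.closedBall (0 : E) ρ) (s : ℝ) : ‖(y s : E) - z s‖ ≤ dist y z := by
    rw [← dist_eq_norm, ← Subtype.dist_eq]
    exact BoundedContinuousFunction.dist_coe_le_dist s
  have hsolve (y : ℝ →ᵇ Metric.closedBall (0 : E) ρ) : ∃ D : ℝ →ᵇ Metric.closedBall (0 : E) ρ,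
      ∀ t, HasDerivAt (fun t => (D t : E)) (-(K • (D t : E)) + G t (y t)) t :=
    exists_solution_in_closedBall_of_damped hK hρ (hG.comp_continuous (continuous_id.prodMk
      (continuous_subtype_val.comp y.continuous)) fun t => ⟨mem_univ t, (y t).2⟩) (hG_le y)
  choose Φ hΦ using hsolve
  have hcontr : ContractingWith (NNReal.mk (k / K) (by positivity)) Φ := by
    refine ⟨NNReal.coe_lt_coe.1 ((div_lt_one hK).2 hkK), LipschitzWith.of_dist_le_mul fun y z => ?_⟩
    refine (BoundedContinuousFunction.dist_le (by positivity)).2 fun t => ?_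
    rw [NNReal.coe_mk, Subtype.dist_eq, dist_eq_norm, div_mul_eq_mul_div]
    exact norm_le_div_of_damped (T := t + 1) (D := fun t => (Φ y t : E) - Φ z t)
      (g := fun t => G t (y t) - G t (z t)) hK
      (fun s _ => ((hΦ y s).sub (hΦ z s)).congr_deriv (by module))
      (fun s _ => (hlip s _ (y s).2 _ (z s).2).trans (mul_le_mul_of_nonneg_left (hdist y z s) hk))
      (fun s _ => hdist (Φ y) (Φ z) s) (lt_add_one t)
  have : Nonempty (ℝ →ᵇ Metric.closedBall (0 : E) ρ) :=
    ⟨.const ℝ ⟨0, Metric.mem_closedBall_self hρ⟩⟩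
  have : CompleteSpace (Metric.closedBall (0 : E) ρ) := Metric.isClosed_closedBall.completeSpace_coe
  obtain ⟨y, hy⟩ : ∃ y, Φ y = y := ⟨_, hcontr.fixedPoint_isFixedPt⟩
  refine ⟨fun t => y t, fun t => mem_closedBall_zero_iff.1 (y t).2, fun t => ?_⟩
  simpa only [hy] using hΦ y t

end DampedEquation

section PullbackAttractor

open scoped Matrix

variable {E : Type*} [NormedAddCommGroup E] [NormedSpace ℝ E] {g : E → ℝ → E} {K l₀ : ℝ} {l : ℝ → ℝ}

omit [NormedSpace ℝ E] in
lemma eventually_forall_closedBall {P : E × ℝ → Prop} (hP : ∀ᶠ z in 𝓝 (0, l₀), P z) :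
    ∀ᶠ ρ in 𝓝[>] (0 : ℝ), ∀ᶠ b in 𝓝 l₀, ∀ y ∈ Metric.closedBall (0 : E) ρ, P (y, b) := by
  obtain ⟨ε, hε, hclose⟩ := Metric.eventually_nhds_iff.1 hP
  filter_upwards [Ioo_mem_nhdsGT hε] with ρ hρ
  filter_upwards [Metric.ball_mem_nhds l₀ hε] with b hb y hy
  exact hclose (max_lt (lt_of_le_of_lt hy hρ.2) hb)

lemma exists_lipschitz_closedBall (hg : ContDiffAt ℝ 1 (Function.uncurry g) (0, l₀))
    (hK : ‖K • ContinuousLinearMap.id ℝ E + fderiv ℝ (fun y => g y l₀) 0‖ < K) :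
    ∃ k, 0 ≤ k ∧ k < K ∧ ∀ᶠ ρ in 𝓝[>] (0 : ℝ), ∀ᶠ b in 𝓝 l₀,
      ∀ y ∈ Metric.closedBall (0 : E) ρ, ∀ z ∈ Metric.closedBall (0 : E) ρ,
        ‖(K • y + g y b) - (K • z + g z b)‖ ≤ k * ‖y - z‖ := by
  set A := K • ContinuousLinearMap.id ℝ E + fderiv ℝ (fun y => g y l₀) 0 with hA
  obtain ⟨k, hAk, hkK⟩ := exists_between hK
  refine ⟨k, (norm_nonneg A).trans hAk.le, hkK, ?_⟩
  have hstrict := hg.hasStrictFDerivAt one_ne_zero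
  have hfderiv : fderiv ℝ (fun y => g y l₀) 0 =
      (fderiv ℝ (Function.uncurry g) (0, l₀)).comp (.inl ℝ E ℝ) :=
    (HasFDerivAt.comp (f := fun y => (y, l₀)) (0 : E) hstrict.hasFDerivAt
      (hasFDerivAt_prodMk_left 0 l₀)).fderiv
  obtain ⟨ε, hε, hclose⟩ :=
    Metric.eventually_nhds_iff.1 (hstrict.isLittleO.def (sub_pos.2 hAk))
  filter_upwards [Ioo_mem_nhdsGT hε] with ρ hρ
  filter_upwards [Metric.ball_mem_nhds l₀ hε] with b hb y hy z hz
  have hmem (x : E) (hx : x ∈ Metric.closedBall (0 : E) ρ) : dist (x, b) (0, l₀) < ε :=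
    max_lt (lt_of_le_of_lt hx hρ.2) hb
  have hrem := hclose (y := ((y, b), (z, b))) (max_lt (hmem y hy) (hmem z hz))
  rw [show ‖(y, b) - (z, b)‖ = ‖y - z‖ by simp [Prod.norm_def]] at hrem
  set R := g y b - g z b - fderiv ℝ (Function.uncurry g) (0, l₀) ((y, b) - (z, b)) with hR
  have hsplit : (K • y + g y b) - (K • z + g z b) = A (y - z) + R := by
    rw [hA, hR, hfderiv, Prod.mk_sub_mk, sub_self]
    simp only [add_apply, smul_apply, ContinuousLinearMap.id_apply, ContinuousLinearMap.comp_apply,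
      ContinuousLinearMap.inl_apply]
    module
  calc ‖(K • y + g y b) - (K • z + g z b)‖
      ≤ ‖A (y - z)‖ + ‖R‖ := hsplit ▸ norm_add_le _ _
    _ ≤ ‖A‖ * ‖y - z‖ + (k - ‖A‖) * ‖y - z‖ := add_le_add (A.le_opNorm _) hrem
    _ = k * ‖y - z‖ := by ring

theorem exists_solution_tendsto_zero [CompleteSpace E]
    (hg : ContDiffAt ℝ 1 (Function.uncurry g) (0, l₀))
    (hK : ‖K • ContinuousLinearMap.id ℝ E + fderiv ℝ (fun y => g y l₀) 0‖ < K)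
    (hg₀ : g 0 l₀ = 0) (hl : Continuous l) (hl₀ : Tendsto l atBot (𝓝 l₀)) :
    ∃ T, ∃ y : ℝ → E, (∀ t < T, HasDerivAt y (g (y t) (l t)) t) ∧ Tendsto y atBot (𝓝 0) := by
  obtain ⟨k, hk, hkK, hlip⟩ := exists_lipschitz_closedBall hg hK
  have hcont : ∀ᶠ z in 𝓝 (0, l₀), ContinuousAt (Function.uncurry g) z :=
    (hg.eventually (by simp)).mono fun _ h => h.continuousAt
  obtain ⟨ρ, ⟨hlip, hcont⟩, hρ⟩ :=
    ((hlip.and (eventually_forall_closedBall hcont)).and self_mem_nhdsWithin).exists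
  have hforcing : Tendsto (fun t => ‖g 0 (l t)‖) atBot (𝓝 0) := by
    simpa [hg₀] using (hg.continuousAt.tendsto.comp (tendsto_const_nhds.prodMk_nhds hl₀)).norm
  obtain ⟨T, hT⟩ := eventually_atBot.1 (((hl₀.eventually hlip).and (hl₀.eventually hcont)).and
    (hforcing.eventually_le_const (mul_pos (sub_pos.2 hkK) hρ)))
  set lT : ℝ → ℝ := fun t => l (min t T)
  have hT' (t : ℝ) := hT (min t T) (min_le_right t T)
  have hG : ContinuousOn (Function.uncurry fun t y => K • y + g y (lT t))
      (univ ×ˢ Metric.closedBall 0 ρ) := fun z hz =>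
    ((continuousAt_snd.const_smul K).add (ContinuousAt.comp (f := fun z : ℝ × E => (z.2, lT z.1))
      ((hT' z.1).1.2 z.2 hz.2) (by fun_prop))).continuousWithinAt
  obtain ⟨y, hyρ, hy⟩ := exists_solution_in_closedBall_of_lipschitz hk hkK hG
    (fun t => (hT' t).1.1) fun t => by simpa using (hT' t).2
  have hy' (t : ℝ) (ht : t < T) :
      HasDerivAt y (-(K • y t) + (K • y t + g (y t) (l t))) t := by
    simpa only [lT, min_eq_left ht.le] using hy t
  refine ⟨T, y, fun t ht => by simpa using hy' t ht,
    tendsto_zero_of_damped hk hkK hy' (fun t ht => ?_) (fun t _ => hyρ t) hforcing⟩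
  have hgrowth := (hT t ht.le).1.1 (y t) (mem_closedBall_zero_iff.2 (hyρ t)) 0
    (Metric.mem_closedBall_self (le_of_lt hρ))
  rw [smul_zero, zero_add, sub_zero] at hgrowth
  exact (norm_le_norm_add_norm_sub' _ _).trans (add_le_add le_rfl hgrowth)

theorem eventuallyEq_of_tendsto_zero (hg : ContDiffAt ℝ 1 (Function.uncurry g) (0, l₀))
    (hK : ‖K • ContinuousLinearMap.id ℝ E + fderiv ℝ (fun y => g y l₀) 0‖ < K)
    (hl₀ : Tendsto l atBot (𝓝 l₀)) {y z : ℝ → E}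
    (hy : ∀ᶠ t in atBot, HasDerivAt y (g (y t) (l t)) t) (hy₀ : Tendsto y atBot (𝓝 0))
    (hz : ∀ᶠ t in atBot, HasDerivAt z (g (z t) (l t)) t) (hz₀ : Tendsto z atBot (𝓝 0)) :
    y =ᶠ[atBot] z := by
  obtain ⟨k, hk, hkK, hlip⟩ := exists_lipschitz_closedBall hg hK
  obtain ⟨ρ, hlip, hρ⟩ := (hlip.and self_mem_nhdsWithin).exists
  have hball : ∀ᶠ x in 𝓝 (0 : E), x ∈ Metric.closedBall 0 ρ := Metric.closedBall_mem_nhds 0 hρ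
  obtain ⟨T, hT⟩ := eventually_atBot.1 (hy.and (hz.and ((hl₀.eventually hlip).and
    ((hy₀.eventually hball).and (hz₀.eventually hball)))))
  filter_upwards [Iio_mem_atBot T] with t ht
  have hle : ‖y t - z t‖ ≤ 0 / (K - k) := by
    refine norm_le_div_sub_of_damped (D := fun t => y t - z t) (M := ρ + ρ)
      (g := fun t => (K • y t + g (y t) (l t)) - (K • z t + g (z t) (l t))) hk hkK
      (fun s hs => ?_) (fun s hs => ?_) (fun s hs => ?_) ht <;>
      obtain ⟨hys, hzs, hlips, hyρ, hzρ⟩ := hT s hs.le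
    · exact (hys.sub hzs).congr_deriv (by module)
    · rw [zero_add]
      exact hlips _ hyρ _ hzρ
    · exact (norm_sub_le _ _).trans
        (add_le_add (mem_closedBall_zero_iff.1 hyρ) (mem_closedBall_zero_iff.1 hzρ))
  rwa [zero_div, norm_le_zero_iff, sub_eq_zero] at hle

lemma eventuallyEq_nhds_of_hasDerivAt (hl : Continuous l) {t : ℝ} {x y : ℝ → E}
    (hg : ContDiffAt ℝ 1 (Function.uncurry g) (x t, l t))
    (hx : ∀ᶠ s in 𝓝 t, HasDerivAt x (g (x s) (l s)) s)
    (hy : ∀ᶠ s in 𝓝 t, HasDerivAt y (g (y s) (l s)) s) (hxy : x t = y t) : x =ᶠ[𝓝 t] y := by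
  obtain ⟨K, V, hV, hK⟩ := hg.exists_lipschitzOnWith
  have hmem {z : ℝ → E} (hz : ContinuousAt z t) (hzx : z t = x t) :
      ∀ᶠ s in 𝓝 t, (z s, l s) ∈ V :=
    (hz.prodMk hl.continuousAt).eventually_mem (by rwa [hzx])
  refine ODE_solution_unique_of_eventually (v := fun s x => g x (l s))
    (s := fun s => {x | (x, l s) ∈ V}) (K := K) (Eventually.of_forall fun s a ha b hb => ?_)
    (hx.and (hmem hx.self_of_nhds.continuousAt rfl))
    (hy.and (hmem hy.self_of_nhds.continuousAt hxy.symm)) hxy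
  simpa [Prod.edist_eq] using hK ha hb

theorem eqOn_of_hasDerivAt {J : Set ℝ} (hJ : IsOpen J) (hJ' : IsPreconnected J)
    (hl : Continuous l) {x y : ℝ → E}
    (hg : ∀ t ∈ J, ContDiffAt ℝ 1 (Function.uncurry g) (x t, l t))
    (hx : ∀ t ∈ J, HasDerivAt x (g (x t) (l t)) t) (hy : ∀ t ∈ J, HasDerivAt y (g (y t) (l t)) t)
    {t₀ : ℝ} (ht₀ : t₀ ∈ J) (hxy : x t₀ = y t₀) : EqOn x y J := by
  have hlocal (t : ℝ) (ht : t ∈ J) (h : x t = y t) : x =ᶠ[𝓝 t] y :=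
    eventuallyEq_nhds_of_hasDerivAt hl (hg t ht) (eventually_of_mem (hJ.mem_nhds ht) hx)
      (eventually_of_mem (hJ.mem_nhds ht) hy) h
  have hsub : J ⊆ {t | x =ᶠ[𝓝 t] y} := by
    refine hJ'.subset_of_closure_inter_subset isOpen_setOfPred_eventually_nhds
      ⟨t₀, ht₀, hlocal t₀ ht₀ hxy⟩ fun t ⟨htc, ht⟩ => hlocal t ht ?_
    have := mem_closure_iff_nhdsWithin_neBot.1 htc
    refine tendsto_nhds_unique_of_eventuallyEq (l := 𝓝[{t | x =ᶠ[𝓝 t] y}] t)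
      ((hx t ht).continuousAt.tendsto.mono_left nhdsWithin_le_nhds)
      ((hy t ht).continuousAt.tendsto.mono_left nhdsWithin_le_nhds)
      (eventually_of_mem self_mem_nhdsWithin fun s (hs : x =ᶠ[𝓝 s] y) => hs.self_of_nhds)
  exact fun t ht => (hsub ht).self_of_nhds

variable {n : ℕ} {U : Set (Fin n → ℝ)} {f : (Fin n → ℝ) → ℝ → (Fin n → ℝ)}

/-- The vector field `f` in the coordinates `y = (x - q) / w`, in which the weighted supremum norm
`maxᵢ |xᵢ - qᵢ| / wᵢ` becomes the standard one. -/
noncomputable def rescale (f : (Fin n → ℝ) → ℝ → (Fin n → ℝ)) (q w : Fin n → ℝ) :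
    (Fin n → ℝ) → ℝ → (Fin n → ℝ) :=
  fun y l => f (q + w * y) l / w

variable {q w : Fin n → ℝ}

lemma add_mul_sub_div (hw : ∀ i, w i ≠ 0) (x : Fin n → ℝ) : q + w * ((x - q) / w) = x := by
  ext i
  simp [mul_div_cancel₀ _ (hw i)]

lemma hasDerivAt_rescale_iff (hw : ∀ i, w i ≠ 0) {x : ℝ → (Fin n → ℝ)} {l t : ℝ} :
    HasDerivAt (fun t => (x t - q) / w) (rescale f q w ((x t - q) / w) l) t ↔
      HasDerivAt x (f (x t) l) t := by
  rw [rescale, add_mul_sub_div hw, hasDerivAt_pi, hasDerivAt_pi]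
  refine forall_congr' fun i => ⟨fun h => ?_, fun h => (h.sub_const (q i)).div_const (w i)⟩
  simpa [div_mul_cancel₀ _ (hw i)] using (h.mul_const (w i)).add_const (q i)

lemma contDiffAt_rescale (hf : ContDiffAt ℝ 1 (Function.uncurry f) (q, l₀)) :
    ContDiffAt ℝ 1 (Function.uncurry (rescale f q w)) (0, l₀) := by
  have haffine : ContDiffAt ℝ 1 (fun z : (Fin n → ℝ) × ℝ => (q + w * z.1, z.2)) (0, l₀) := by
    fun_prop
  have hcomp : ContDiffAt ℝ 1 (fun z : (Fin n → ℝ) × ℝ => f (q + w * z.1) z.2) (0, l₀) :=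
    ContDiffAt.comp (g := Function.uncurry f) (0, l₀) (by simpa using hf) haffine
  exact contDiffAt_pi.2 fun i => (contDiffAt_pi.1 hcomp i).div_const (w i)

lemma fderiv_rescale_apply (hf : DifferentiableAt ℝ (fun x => f x l₀) q) (v : Fin n → ℝ) :
    fderiv ℝ (fun y => rescale f q w y l₀) 0 v = jacobian (fun x => f x l₀) q *ᵥ (w * v) / w := by
  have hinner : HasFDerivAt (fun y => q + w * y) (ContinuousLinearMap.mul ℝ _ w) 0 :=
    (ContinuousLinearMap.mul ℝ _ w).hasFDerivAt.const_add q
  have hmid : HasFDerivAt (fun x => f x l₀) (fderiv ℝ (fun x => f x l₀) q) (q + w * 0) := by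
    simpa using hf.hasFDerivAt
  have houter := ((ContinuousLinearMap.mul ℝ _ w⁻¹).hasFDerivAt.comp _ (hmid.comp 0 hinner)).fderiv
  have hrescale : (fun y => rescale f q w y l₀) = ContinuousLinearMap.mul ℝ _ w⁻¹ ∘
      (fun x => f x l₀) ∘ fun y => q + w * y := by
    ext1 y
    exact div_eq_inv_mul _ _
  rw [hrescale, houter, jacobian_mulVec, div_eq_inv_mul]
  rfl

lemma norm_smul_id_add_fderiv_rescale_le (hf : DifferentiableAt ℝ (fun x => f x l₀) q)
    (hA : IsMetzler (jacobian (fun x => f x l₀) q)) (hw : StrongLT 0 w) {k : ℝ} (hk : 0 ≤ k)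
    (hK : ∀ i, 0 ≤ K + jacobian (fun x => f x l₀) q i i ∧
      K * w i + (jacobian (fun x => f x l₀) q *ᵥ w) i ≤ k * w i) :
    ‖K • ContinuousLinearMap.id ℝ (Fin n → ℝ) + fderiv ℝ (fun y => rescale f q w y l₀) 0‖ ≤ k := by
  refine ContinuousLinearMap.opNorm_le_bound _ hk fun v => ?_
  simpa [fderiv_rescale_apply hf] using
    hA.norm_smul_add_mulVec_div_le hw hk (fun i => (hK i).1) fun i => (hK i).2

theorem hasPullbackAttractor (hU : IsOpen U)
    (hf : ContDiffOn ℝ 1 (Function.uncurry f) (U ×ˢ univ)) (hq : q ∈ U)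
    (hmono : IsMonotoneSystem U fun x => f x l₀)
    (hatt : IsAttractingEquilibrium (fun x => f x l₀) q) (hl : Continuous l)
    (hl₀ : Tendsto l atBot (𝓝 l₀)) {r : ℝ} (hr : 0 < r) : HasPullbackAttractor U f l r q := by
  have hA : IsMetzler (jacobian (fun x => f x l₀) q) := hmono q hq
  obtain ⟨w, hw, hAw⟩ := hA.exists_pos_mulVec_neg hatt.2
  obtain ⟨K, k, hk, hkK, hdamp⟩ := exists_damping_of_mulVec_neg hAw
  have hK := (norm_smul_id_add_fderiv_rescale_le (differentiableAt_section hU hf hq l₀) hA hw hk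
    hdamp).trans_lt hkK
  have hg : ContDiffAt ℝ 1 (Function.uncurry (rescale f q w)) (0, l₀) :=
    contDiffAt_rescale (contDiffAt_uncurry hU hf hq l₀)
  have hlr : Continuous fun t => l (r * t) := by fun_prop
  have hlr₀ : Tendsto (fun t => l (r * t)) atBot (𝓝 l₀) :=
    hl₀.comp (tendsto_id.const_mul_atBot hr)
  have hw' (i) : w i ≠ 0 := (hw i).ne'
  refine ⟨?_, fun T x y hx hy => ?_⟩
  · have hg₀ : rescale f q w 0 l₀ = 0 := by simp [rescale, hatt.1, div_eq_inv_mul]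
    obtain ⟨T, y, hy, hy₀⟩ := exists_solution_tendsto_zero hg hK hg₀ hlr hlr₀
    obtain ⟨x, rfl⟩ : ∃ x : ℝ → (Fin n → ℝ), y = fun t => (x t - q) / w :=
      ⟨fun t => q + w * y t, by ext t i; simp [mul_div_cancel_left₀ _ (hw' i)]⟩
    have hx₀ : Tendsto x atBot (𝓝 q) := by
      simpa [add_mul_sub_div hw'] using (hy₀.const_mul w).const_add q
    obtain ⟨S, hS⟩ := eventually_atBot.1 (hx₀.eventually (hU.mem_nhds hq))
    exact ⟨min S T, x, fun t ht => hS t (ht.trans_le (min_le_left S T)).le,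
      fun t ht => (hasDerivAt_rescale_iff hw').1 (hy t (ht.trans_le (min_le_right S T))), hx₀⟩
  · have hder {x : ℝ → (Fin n → ℝ)} (hx : IsPullbackTrajectory U f l r q (Iio T) x) :
        ∀ᶠ t in atBot, HasDerivAt (fun t => (x t - q) / w)
          (rescale f q w ((x t - q) / w) (l (r * t))) t :=
      eventually_of_mem (Iio_mem_atBot T) fun t ht =>
        (hasDerivAt_rescale_iff hw').2 (hx.hasDerivAt t ht)
    have hlim {x : ℝ → (Fin n → ℝ)} (hx : IsPullbackTrajectory U f l r q (Iio T) x) :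
        Tendsto (fun t => (x t - q) / w) atBot (𝓝 0) := by
      simpa [div_eq_inv_mul] using (hx.tendsto_atBot.sub_const q).const_mul w⁻¹
    have hev := eventuallyEq_of_tendsto_zero hg hK hlr₀ (hder hx) (hlim hx) (hder hy) (hlim hy)
    obtain ⟨t, hxy, ht⟩ := (hev.and (Iio_mem_atBot T)).exists
    refine eqOn_of_hasDerivAt isOpen_Iio isPreconnected_Iio hlr
      (fun t ht => contDiffAt_uncurry hU hf (hx.mem t ht) _) hx.hasDerivAt hy.hasDerivAt ht ?_
    rw [← add_mul_sub_div (q := q) hw' (x t), show (x t - q) / w = (y t - q) / w from hxy,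
      add_mul_sub_div hw']

end PullbackAttractor

section LowerCurves

open scoped Matrix NNReal

lemma exists_continuous_direction {ι S : Type*} [Fintype ι] [TopologicalSpace S] [NormalSpace S]
    [ParacompactSpace S] {A : S → Matrix ι ι ℝ} (hA : Continuous A) {C : Set (ι → ℝ)}
    (hC : Convex ℝ C) (hdir : ∀ s, ∃ W ∈ C, StrongLT 0 (A s *ᵥ W)) :
    ∃ W : C(S, ι → ℝ), ∀ s, W s ∈ C ∧ StrongLT 0 (A s *ᵥ W s) := by
  refine exists_continuous_forall_mem_convex_of_local_const
    (t := fun s => {W | W ∈ C ∧ StrongLT 0 (A s *ᵥ W)}) (fun s => hC.inter ?_) fun s => ?_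
  · intro V hV W hW a b ha hb hab i
    rw [Matrix.mulVec_add, Matrix.mulVec_smul, Matrix.mulVec_smul]
    exact convex_Ioi (0 : ℝ) (hV i) (hW i) ha hb hab
  · obtain ⟨W, hWC, hW⟩ := hdir s
    refine ⟨W, (eventually_all.2 fun i => ?_).mono fun s' h => ⟨hWC, h⟩⟩
    exact ((continuous_apply i).comp (hA.matrix_mulVec continuous_const)).continuousAt
      |>.eventually_const_lt (hW i)

variable {n : ℕ} {U : Set (Fin n → ℝ)} {f : (Fin n → ℝ) → ℝ → (Fin n → ℝ)}

/-- `z = (x, λ)` is an equilibrium `x ∈ U` of `x' = f(x, λ)`, and some direction in the cone `C`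
along which one can leave `x` makes all components of the vector field increase. -/
structure HasIncreasingDirection (U : Set (Fin n → ℝ)) (f : (Fin n → ℝ) → ℝ → (Fin n → ℝ))
    (C : ConvexCone ℝ (Fin n → ℝ)) (z : (Fin n → ℝ) × ℝ) : Prop where
  mem : z.1 ∈ U
  equilibrium : f z.1 z.2 = 0
  exists_direction : ∃ W ∈ C, StrongLT 0 (jacobian (fun x => f x z.2) z.1 *ᵥ W)

/-- The points of `U` at distance less than `e` from `z.1`, in a direction from the cone `C`, at
which all components of the vector field `f(·, z.2)` exceed `ρ`. -/
def displacedPoints (U : Set (Fin n → ℝ)) (f : (Fin n → ℝ) → ℝ → (Fin n → ℝ))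
    (C : ConvexCone ℝ (Fin n → ℝ)) (e ρ : ℝ) (z : (Fin n → ℝ) × ℝ) : Set (Fin n → ℝ) :=
  {x | x ∈ U ∧ ‖x - z.1‖ < e ∧ x - z.1 ∈ C ∧ ∀ i, ρ < f x z.2 i}

variable {C : ConvexCone ℝ (Fin n → ℝ)} {e : ℝ} {z : (Fin n → ℝ) × ℝ}

lemma eventually_forall_displacedPoints {P : (Fin n → ℝ) → Prop}
    (h : ∀ᶠ x in 𝓝 z.1, P x) :
    ∀ᶠ e in 𝓝 (0 : ℝ), ∀ ρ, ∀ x ∈ displacedPoints U f C e ρ z, P x := by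
  obtain ⟨ε, hε, hP⟩ := Metric.eventually_nhds_iff.1 h
  filter_upwards [eventually_lt_nhds hε] with e he ρ x hx
  exact hP ((dist_eq_norm x z.1).trans_lt (hx.2.1.trans he))

lemma eventually_pos_of_hasStrictFDerivAt {S E : Type*} [TopologicalSpace S] [NormedAddCommGroup E]
    [NormedSpace ℝ E] {F : E → ℝ} {D : E →L[ℝ] ℝ} {X W : S → E} {s : S}
    (hF : HasStrictFDerivAt F D (X s)) (hX : Continuous X) (hW : Continuous W)
    (hX₀ : ∀ s, F (X s) = 0) (hpos : 0 < D (W s)) :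
    ∀ᶠ z : ℝ × S in 𝓝 (0, s), 0 < z.1 → 0 < F (X z.2 + z.1 • W z.2) := by
  set w := ‖W s‖ + 1
  set c := D (W s) / 2
  have hlim : Tendsto (fun z : ℝ × S => (X z.2 + z.1 • W z.2, X z.2)) (𝓝 (0, s))
      (𝓝 (X s, X s)) := by
    have : Continuous fun z : ℝ × S => (X z.2 + z.1 • W z.2, X z.2) := by fun_prop
    simpa using this.tendsto (0, s)
  have herror := hlim.eventually
    (hF.isLittleO.def (c := c / w) (by positivity))
  have hD : ∀ᶠ z : ℝ × S in 𝓝 (0, s), c < D (W z.2) :=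
    (by fun_prop : Continuous fun z : ℝ × S => D (W z.2)).continuousAt.eventually_const_lt
      (half_lt_self hpos)
  have hnorm : ∀ᶠ z : ℝ × S in 𝓝 (0, s), ‖W z.2‖ < w :=
    (by fun_prop : Continuous fun z : ℝ × S => ‖W z.2‖).continuousAt.eventually_lt_const
      (lt_add_one _)
  filter_upwards [herror, hD, hnorm] with ⟨η, s'⟩ herror hD hnorm hη
  dsimp only at herror hD hnorm hη ⊢
  rw [hX₀, add_sub_cancel_left, map_smul, smul_eq_mul, norm_smul, Real.norm_of_nonneg hη.le,
    sub_zero, Real.norm_eq_abs] at herror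
  have hsmall : c / w * (η * ‖W s'‖) ≤ η * c := by
    have : ‖W s'‖ / w ≤ 1 := (div_le_one (by positivity)).2 hnorm.le
    calc c / w * (η * ‖W s'‖) = η * c * (‖W s'‖ / w) := by ring
      _ ≤ η * c := mul_le_of_le_one_right (by positivity) this
  have hlower := (abs_le.1 herror).1
  have hgain := mul_lt_mul_of_pos_left hD hη
  linarith

lemma jacobian_mulVec_eq_fderiv_uncurry {x : Fin n → ℝ} {l : ℝ}
    (hf : DifferentiableAt ℝ (Function.uncurry f) (x, l)) (v : Fin n → ℝ) :
    jacobian (fun x => f x l) x *ᵥ v = fderiv ℝ (Function.uncurry f) (x, l) (v, 0) := by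
  rw [jacobian_mulVec]
  have hsection := hf.hasFDerivAt.comp (f := fun x => (x, l)) x
    ((hasFDerivAt_id x).prodMk (hasFDerivAt_const l x))
  exact congrArg (· v) hsection.fderiv

lemma exists_forall_displacement_mem {K : Set ((Fin n → ℝ) × ℝ)} (hK : IsCompact K)
    (hU : IsOpen U) (hf : ContDiffOn ℝ 1 (Function.uncurry f) (U ×ˢ univ)) {W : C(K, Fin n → ℝ)}
    (hmem : ∀ k ∈ K, HasIncreasingDirection U f C k)
    (hW : ∀ k, W k ∈ C ∧ StrongLT 0 (jacobian (fun x => f x k.1.2) k.1.1 *ᵥ W k)) (he : 0 < e) :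
    ∃ η : ℝ, ∀ k : K, k.1.1 + η • W k ∈ displacedPoints U f C e 0 k := by
  have : CompactSpace K := isCompact_iff_compactSpace.1 hK
  have hsmall : ∀ᶠ η : ℝ in 𝓝 0, ∀ k ∈ (univ : Set K), 0 < η →
      k.1.1 + η • W k ∈ displacedPoints U f C e 0 k := by
    refine isCompact_univ.eventually_forall_of_forall_eventually fun k _ => ?_
    have hU' : ∀ᶠ z : ℝ × K in 𝓝 (0, k), z.2.1.1 + z.1 • W z.2 ∈ U :=
      (by fun_prop : Continuous fun z : ℝ × K => z.2.1.1 + z.1 • W z.2).continuousAt.eventually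
        (hU.mem_nhds (by simpa using (hmem k k.2).mem))
    have he' : ∀ᶠ z : ℝ × K in 𝓝 (0, k), ‖z.1 • W z.2‖ < e :=
      (by fun_prop : Continuous fun z : ℝ × K => ‖z.1 • W z.2‖).continuousAt.eventually_lt_const
        (by simpa using he)
    have hpos : ∀ᶠ z : ℝ × K in 𝓝 (0, k), ∀ i, 0 < z.1 →
        0 < f (z.2.1.1 + z.1 • W z.2) z.2.1.2 i := by
      have hfk := contDiffAt_uncurry hU hf (hmem k k.2).mem k.1.2
      refine eventually_all.2 fun i => ?_
      have hi := eventually_pos_of_hasStrictFDerivAt (X := fun k : K => k.1)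
        (W := fun k : K => (W k, (0 : ℝ)))
        (hasStrictFDerivAt_pi'.1 (hfk.hasStrictFDerivAt one_ne_zero) i) (by fun_prop) (by fun_prop)
        (fun k => congrFun (hmem k k.2).equilibrium i) (by
          have := (hW k).2 i
          rwa [jacobian_mulVec_eq_fderiv_uncurry (hfk.differentiableAt one_ne_zero)] at this)
      simpa [Function.uncurry] using hi
    filter_upwards [hU', he', hpos] with ⟨η, k'⟩ hU' he' hpos hη
    exact ⟨hU', by simpa using he', by simpa using C.smul_mem hη (hW k').1, fun i => hpos i hη⟩
  obtain ⟨η, hη₀, hη⟩ := hsmall.exists_gt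
  exact ⟨η, fun k => hη k (mem_univ k) hη₀⟩

lemma eventually_mem_displacedPoints (hU : IsOpen U)
    (hf : ContDiffOn ℝ 1 (Function.uncurry f) (U ×ˢ univ)) (hC : IsOpen (C : Set (Fin n → ℝ)))
    {x : Fin n → ℝ} {ρ : ℝ} (hx : x ∈ displacedPoints U f C e ρ z) :
    ∀ᶠ p : (Fin n → ℝ) × ℝ × ((Fin n → ℝ) × ℝ) in 𝓝 (x, ρ, z),
      p.1 ∈ displacedPoints U f C e p.2.1 p.2.2 := by
  obtain ⟨hxU, hxe, hxC, hxf⟩ := hx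
  have hsub : Continuous fun p : (Fin n → ℝ) × ℝ × ((Fin n → ℝ) × ℝ) => p.1 - p.2.2.1 := by
    fun_prop
  have hsection : Continuous fun p : (Fin n → ℝ) × ℝ × ((Fin n → ℝ) × ℝ) => (p.1, p.2.2.2) := by
    fun_prop
  have hfield : ContinuousAt (fun p : (Fin n → ℝ) × ℝ × ((Fin n → ℝ) × ℝ) => f p.1 p.2.2.2)
      (x, ρ, z) :=
    (contDiffAt_uncurry hU hf hxU z.2).continuousAt.tendsto.comp (hsection.tendsto (x, ρ, z))
  exact (continuousAt_fst.eventually (hU.mem_nhds hxU)).and <|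
    ((hsub.norm.tendsto (x, ρ, z)).eventually_lt_const hxe).and <|
    ((hsub.tendsto (x, ρ, z)).eventually (hC.mem_nhds hxC)).and <|
    eventually_all.2 fun i =>
      ContinuousAt.eventually_lt (by fun_prop) (continuousAt_pi.1 hfield i) (hxf i)

theorem exists_continuous_ball_subset_displacedPoints {K : Set ((Fin n → ℝ) × ℝ)} (hK : IsCompact K)
    (hU : IsOpen U) (hf : ContDiffOn ℝ 1 (Function.uncurry f) (U ×ˢ univ))
    (hC : IsOpen (C : Set (Fin n → ℝ))) (hmem : ∀ k ∈ K, HasIncreasingDirection U f C k)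
    (he : 0 < e) :
    ∃ (Y : C(K, Fin n → ℝ)) (ρ : ℝ), 0 < ρ ∧
      ∀ k : K, Metric.ball (Y k) ρ ⊆ displacedPoints U f C e ρ k := by
  have : CompactSpace K := isCompact_iff_compactSpace.1 hK
  have hjac : Continuous fun k : K => jacobian (fun x => f x k.1.2) k.1.1 :=
    continuous_iff_continuousAt.2 fun k =>
      (continuousAt_jacobian hU hf (hmem k k.2).mem k.1.2).comp (f := Subtype.val)
        continuousAt_subtype_val
  obtain ⟨W, hW⟩ := exists_continuous_direction hjac C.convex
    fun k => (hmem k k.2).exists_direction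
  obtain ⟨η, hmemη⟩ := exists_forall_displacement_mem hK hU hf hmem hW he
  set Y : C(K, Fin n → ℝ) := ⟨fun k => k.1.1 + η • W k, by fun_prop⟩
  have htube : ∀ᶠ p : (Fin n → ℝ) × ℝ in 𝓝 0, ∀ k ∈ (univ : Set K),
      Y k + p.1 ∈ displacedPoints U f C e p.2 k := by
    refine isCompact_univ.eventually_forall_of_forall_eventually fun k _ => ?_
    have hcont : Continuous fun q : ((Fin n → ℝ) × ℝ) × K => (Y q.2 + q.1.1, q.1.2, q.2.1) := by
      fun_prop
    exact (hcont.tendsto' (0, k) (Y k, 0, k) (by simp)).eventually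
      (eventually_mem_displacedPoints hU hf hC (hmemη k))
  obtain ⟨ε, hε, hball⟩ := Metric.eventually_nhds_iff.1 htube
  refine ⟨Y, ε / 2, half_pos hε, fun k x hx => ?_⟩
  have hdist : dist (x - Y k, ε / 2) (0 : (Fin n → ℝ) × ℝ) < ε := by
    rw [Prod.dist_eq, max_lt_iff, Prod.fst_zero, Prod.snd_zero, dist_zero_right, dist_zero_right,
      ← dist_eq_norm, Real.norm_of_nonneg (half_pos hε).le]
    exact ⟨(Metric.mem_ball.1 hx).trans (half_lt_self hε), half_lt_self hε⟩
  simpa using hball hdist k (mem_univ k)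

lemma exists_mem_displacedPoints (hU : IsOpen U)
    (hf : ContDiffOn ℝ 1 (Function.uncurry f) (U ×ˢ univ)) (hC : IsOpen (C : Set (Fin n → ℝ)))
    (hz : HasIncreasingDirection U f C z) (he : 0 < e) :
    ∃ x, ∃ ρ > 0, x ∈ displacedPoints U f C e ρ z := by
  obtain ⟨Y, ρ, hρ, hY⟩ := exists_continuous_ball_subset_displacedPoints (K := {z})
    isCompact_singleton hU hf hC (by rintro _ rfl; exact hz) he
  exact ⟨Y ⟨z, rfl⟩, ρ, hρ, hY ⟨z, rfl⟩ (Metric.mem_ball_self hρ)⟩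

lemma exists_lipschitz_approx_Iic {E : Type*} [NormedAddCommGroup E] [NormedSpace ℝ E]
    {Y : ℝ → E} {Y₀ : E} (hY : Continuous Y) (hlim : Tendsto Y atBot (𝓝 Y₀)) (u : ℝ) {ρ : ℝ}
    (hρ : 0 < ρ) :
    ∃ (y : ℝ → E) (b : E) (K : ℝ≥0), LipschitzWith K y ∧ (∀ s ≤ u, dist (y s) (Y s) < ρ) ∧
      dist b Y₀ < ρ ∧ ∀ᶠ s in atBot, y s = b := by
  have hρ' : 0 < ρ / 3 := by positivity
  obtain ⟨a, ha⟩ := eventually_atBot.1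
    ((eventually_le_atBot u).and (Metric.tendsto_nhds.1 hlim (ρ / 3) hρ'))
  have hau : a ≤ u := (ha a le_rfl).1
  obtain ⟨p, hp, hpY, -⟩ := hY.exists_contDiff_approx 1 continuous_const fun _ => hρ'
  obtain ⟨K, hK⟩ := hp.contDiffOn.exists_lipschitzOnWith one_ne_zero (convex_Icc a u)
    isCompact_Icc
  have hpa : dist (p a) Y₀ < 2 * (ρ / 3) := by
    linarith [dist_triangle (p a) (Y a) Y₀, hpY a, (ha a le_rfl).2]
  have hleft : ∀ s ≤ a, p (projIcc a u hau s) = p a := fun s hs => by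
    rw [projIcc_of_le_left hau hs]
  refine ⟨fun s => p (projIcc a u hau s), p a, K, ?_, fun s hs => ?_, by linarith,
    (eventually_le_atBot a).mono hleft⟩
  · simpa [Function.comp_def] using
      (lipschitzOnWith_iff_restrict.1 hK).comp (LipschitzWith.projIcc hau)
  · dsimp only
    rcases le_total s a with hsa | has
    · rw [hleft s hsa]
      linarith [dist_triangle_right (p a) (Y s) Y₀, (ha s hsa).2]
    · rw [projIcc_of_mem hau ⟨has, hs⟩]
      linarith [hpY s]

lemma isCompact_insert_image_Iic {E : Type*} [TopologicalSpace E] {c : ℝ → E} {k₀ : E}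
    (hc : Continuous c) (hlim : Tendsto c atBot (𝓝 k₀)) (u : ℝ) :
    IsCompact (insert k₀ (c '' Iic u)) := by
  have hfold : Tendsto (fun s : ℝ => u - ‖s‖) (cocompact ℝ) atBot :=
    tendsto_atBot_add_const_left _ u (tendsto_neg_atTop_atBot.comp tendsto_norm_cocompact_atTop)
  have hrange : range (fun s : ℝ => u - ‖s‖) = Iic u := by
    ext s
    refine ⟨?_, fun hs => ⟨u - s, ?_⟩⟩
    · rintro ⟨t, rfl⟩
      exact sub_le_self u (norm_nonneg t)
    · dsimp only
      rw [Real.norm_of_nonneg (sub_nonneg.2 hs), sub_sub_cancel]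
  rw [← hrange, ← range_comp]
  exact (hlim.comp hfold).isCompact_insert_range_of_cocompact (by fun_prop)

theorem exists_lower_curve_atBot (hU : IsOpen U)
    (hf : ContDiffOn ℝ 1 (Function.uncurry f) (U ×ˢ univ)) (hC : IsOpen (C : Set (Fin n → ℝ)))
    {c : ℝ → (Fin n → ℝ) × ℝ} (hc : Continuous c) (hlim : Tendsto c atBot (𝓝 z)) {u : ℝ}
    (hdir : ∀ s ≤ u, HasIncreasingDirection U f C (c s)) (hz : HasIncreasingDirection U f C z)
    (he : 0 < e) :
    ∃ (y : ℝ → (Fin n → ℝ)) (b : Fin n → ℝ) (K : ℝ≥0) (ρ : ℝ), 0 < ρ ∧ LipschitzWith K y ∧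
      (∀ s ≤ u, y s ∈ displacedPoints U f C e ρ (c s)) ∧ b ∈ displacedPoints U f C e ρ z ∧
      ∀ᶠ s in atBot, y s = b := by
  obtain ⟨Y, ρ, hρ, hY⟩ := exists_continuous_ball_subset_displacedPoints
    (isCompact_insert_image_Iic hc hlim u) hU hf hC (by
      rintro k (rfl | ⟨s, hs, rfl⟩)
      exacts [hz, hdir s hs]) he
  have hmem : ∀ s, c (min s u) ∈ insert z (c '' Iic u) := fun s =>
    mem_insert_of_mem _ (mem_image_of_mem c (min_le_right s u))
  let k : ℝ → ↥(insert z (c '' Iic u)) := fun s => ⟨c (min s u), hmem s⟩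
  have hkcont : Continuous k := by fun_prop
  have hk : ∀ s ≤ u, k s = c s := fun s hs => congrArg c (min_eq_left hs)
  have hklim : Tendsto k atBot (𝓝 ⟨z, mem_insert z _⟩) := by
    refine tendsto_subtype_rng.2 (hlim.congr' ?_)
    filter_upwards [eventually_le_atBot u] with s hs using (hk s hs).symm
  obtain ⟨y, b, K, hK, hyY, hbY, hyb⟩ := exists_lipschitz_approx_Iic
    (Y.continuous.comp hkcont) ((Y.continuous.tendsto _).comp hklim) u hρ
  refine ⟨y, b, K, ρ, hρ, hK, fun s hs => ?_, hY ⟨z, mem_insert z _⟩ hbY, hyb⟩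
  rw [← hk s hs]
  exact hY (k s) (hyY s hs)

theorem exists_lower_curve_atTop (hU : IsOpen U)
    (hf : ContDiffOn ℝ 1 (Function.uncurry f) (U ×ˢ univ)) (hC : IsOpen (C : Set (Fin n → ℝ)))
    {c : ℝ → (Fin n → ℝ) × ℝ} (hc : Continuous c) (hlim : Tendsto c atTop (𝓝 z)) {v : ℝ}
    (hdir : ∀ s ≥ v, HasIncreasingDirection U f C (c s)) (hz : HasIncreasingDirection U f C z)
    (he : 0 < e) :
    ∃ (y : ℝ → (Fin n → ℝ)) (b : Fin n → ℝ) (K : ℝ≥0) (ρ : ℝ), 0 < ρ ∧ LipschitzWith K y ∧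
      (∀ s ≥ v, y s ∈ displacedPoints U f C e ρ (c s)) ∧ b ∈ displacedPoints U f C e ρ z ∧
      ∀ᶠ s in atTop, y s = b := by
  obtain ⟨y, b, K, ρ, hρ, hK, hy, hb, hyb⟩ := exists_lower_curve_atBot hU hf hC
    (hc.comp continuous_neg) (hlim.comp tendsto_neg_atBot_atTop) (u := -v)
    (fun s hs => hdir (-s) (le_neg.1 hs)) hz he
  refine ⟨fun s => y (-s), b, K, ρ, hρ, ?_, fun s hs => ?_, hb,
    tendsto_neg_atTop_atBot.eventually hyb⟩
  · simpa [Function.comp_def] using hK.comp (LipschitzWith.id.neg)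
  · simpa using hy (-s) (neg_le_neg hs)

end LowerCurves

section Reparametrization

variable {u v ε δ t : ℝ}

lemma IsParameterShift.mem_Icc {lm lp : ℝ} {L : ℝ → ℝ}
    (hL : IsParameterShift lm lp L) (s : ℝ) : L s ∈ Icc lm lp :=
  Ioo_subset_Icc_self (hL.mem_Ioo s)

lemma IsParameterShift.comp {lm lp : ℝ} {L σ : ℝ → ℝ} (hL : IsParameterShift lm lp L)
    (hσ : IsReparametrization σ) (hbot : IsBoundedUnder (· ≤ ·) atBot (norm ∘ deriv σ))
    (htop : IsBoundedUnder (· ≤ ·) atTop (norm ∘ deriv σ)) : IsParameterShift lm lp (L ∘ σ) := by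
  have hderiv : deriv (L ∘ σ) = fun t => deriv L (σ t) * deriv σ t := funext fun t =>
    deriv_comp t (hL.contDiff.differentiable two_ne_zero _)
      (hσ.contDiff.differentiable two_ne_zero _)
  refine ⟨hL.contDiff.comp hσ.contDiff, fun s => hL.mem_Ioo _,
    hL.tendsto_atBot.comp hσ.tendsto_atBot, hL.tendsto_atTop.comp hσ.tendsto_atTop, ?_, ?_⟩
  · rw [hderiv]
    exact (hL.deriv_atBot.comp hσ.tendsto_atBot).zero_mul_isBoundedUnder_le hbot
  · rw [hderiv]
    exact (hL.deriv_atTop.comp hσ.tendsto_atTop).zero_mul_isBoundedUnder_le htop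

/-- The change of time that moves from `-∞` to `u` at the slow rate `ε`, jumps by `v - u` during
`[0, δ]`, and moves on to `+∞` at the rate `ε`. -/
noncomputable def jumpTime (u v ε δ t : ℝ) : ℝ :=
  u + ε * t + (v - u) * Real.smoothTransition (t / δ)

lemma jumpTime_of_nonpos (hδ : 0 < δ) (ht : t ≤ 0) : jumpTime u v ε δ t = u + ε * t := by
  rw [jumpTime, Real.smoothTransition.zero_of_nonpos (div_nonpos_of_nonpos_of_nonneg ht hδ.le),
    mul_zero, add_zero]

lemma jumpTime_of_le (hδ : 0 < δ) (ht : δ ≤ t) : jumpTime u v ε δ t = v + ε * t := by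
  rw [jumpTime, Real.smoothTransition.one_of_one_le ((one_le_div hδ).2 ht)]
  ring

lemma contDiff_jumpTime (u v ε δ : ℝ) : ContDiff ℝ 2 (jumpTime u v ε δ) :=
  (contDiff_const.add (contDiff_const.mul contDiff_id)).add <|
    contDiff_const.mul <| Real.smoothTransition.contDiff.comp (contDiff_id.div_const δ)

lemma deriv_affine (w ε : ℝ) : deriv (fun t => w + ε * t) = fun _ => ε := by
  ext t
  simp

lemma deriv_jumpTime_of_neg (hδ : 0 < δ) (ht : t < 0) : deriv (jumpTime u v ε δ) t = ε := by
  have heq : EqOn (jumpTime u v ε δ) (fun t => u + ε * t) (Iio 0) := fun s hs =>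
    jumpTime_of_nonpos hδ (mem_Iio.1 hs).le
  rw [heq.deriv isOpen_Iio ht, deriv_affine]

lemma deriv_jumpTime_of_lt (hδ : 0 < δ) (ht : δ < t) : deriv (jumpTime u v ε δ) t = ε := by
  have heq : EqOn (jumpTime u v ε δ) (fun t => v + ε * t) (Ioi δ) := fun s hs =>
    jumpTime_of_le hδ (mem_Ioi.1 hs).le
  rw [heq.deriv isOpen_Ioi ht, deriv_affine]

lemma deriv_jumpTime_pos (huv : u ≤ v) (hε : 0 < ε) (hδ : 0 < δ) (t : ℝ) :
    0 < deriv (jumpTime u v ε δ) t := by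
  have hmono : Monotone fun t => (v - u) * Real.smoothTransition (t / δ) := fun a b hab =>
    mul_le_mul_of_nonneg_left (Real.smoothTransition.monotone
      (div_le_div_of_nonneg_right hab hδ.le)) (sub_nonneg.2 huv)
  have hjump : HasDerivAt (fun t => (v - u) * Real.smoothTransition (t / δ))
      (deriv (jumpTime u v ε δ) t - ε) t := by
    have h := ((contDiff_jumpTime u v ε δ).differentiable two_ne_zero t).hasDerivAt.sub
      (((hasDerivAt_id t).const_mul ε).const_add u)
    simpa [jumpTime, Pi.sub_def] using h
  have := hmono.deriv_nonneg (x := t)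
  rw [hjump.deriv] at this
  linarith

lemma isReparametrization_jumpTime (huv : u ≤ v) (hε : 0 < ε) (hδ : 0 < δ) :
    IsReparametrization (jumpTime u v ε δ) where
  contDiff := contDiff_jumpTime u v ε δ
  deriv_pos := deriv_jumpTime_pos huv hε hδ
  tendsto_atBot := (tendsto_atBot_add_const_left _ u (tendsto_id.const_mul_atBot hε)).congr' <|
    (eventually_le_atBot 0).mono fun _ ht => (jumpTime_of_nonpos hδ ht).symm
  tendsto_atTop := (tendsto_atTop_add_const_left _ v (tendsto_id.const_mul_atTop hε)).congr' <|
    (eventually_ge_atTop δ).mono fun _ ht => (jumpTime_of_le hδ ht).symm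

lemma IsParameterShift.comp_jumpTime {lm lp : ℝ} {L : ℝ → ℝ} (hL : IsParameterShift lm lp L)
    (huv : u ≤ v) (hε : 0 < ε) (hδ : 0 < δ) : IsParameterShift lm lp (L ∘ jumpTime u v ε δ) :=
  hL.comp (isReparametrization_jumpTime huv hε hδ)
    (isBoundedUnder_of_eventually_le <| (eventually_lt_atBot 0).mono fun _ ht =>
      (congrArg norm (deriv_jumpTime_of_neg hδ ht)).le)
    (isBoundedUnder_of_eventually_le <| (eventually_gt_atTop δ).mono fun _ ht =>
      (congrArg norm (deriv_jumpTime_of_lt hδ ht)).le)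

end Reparametrization

section Tipping

open scoped NNReal

variable {n : ℕ} {U : Set (Fin n → ℝ)} {f : (Fin n → ℝ) → ℝ → (Fin n → ℝ)} {I : Set ℝ}
  {l : ℝ → ℝ}

lemma eventually_strongLT_right {a b : Fin n → ℝ} (h : StrongLT a b) :
    ∀ᶠ x in 𝓝 b, StrongLT a x :=
  eventually_all.2 fun i => (continuous_apply i).continuousAt.eventually_const_lt (h i)

lemma eventually_strongLT_left {a b : Fin n → ℝ} (h : StrongLT a b) :
    ∀ᶠ x in 𝓝 a, StrongLT x b :=
  eventually_all.2 fun i => (continuous_apply i).continuousAt.eventually_lt_const (h i)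

lemma isStrictLowerSolution_const {J : Set ℝ} {c : Fin n → ℝ} (hc : c ∈ U)
    (h : ∀ t ∈ J, ∀ i, 0 < f c (l t) i) : IsStrictLowerSolution U f l J 0 fun _ => c :=
  ⟨continuousOn_const, fun _ _ => hc, by simp, h⟩

lemma isStrictLowerSolution_of_lipschitzWith {J : Set ℝ} {K : ℝ≥0} {y : ℝ → (Fin n → ℝ)}
    (hy : LipschitzWith K y) {w ε : ℝ} (hε : 0 ≤ ε)
    (h : ∀ t ∈ J, y (w + ε * t) ∈ U ∧ ∀ i, K * ε < f (y (w + ε * t)) (l t) i) :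
    IsStrictLowerSolution U f l J (K * ε) fun t => y (w + ε * t) where
  continuousOn := (hy.continuous.comp (by fun_prop)).continuousOn
  mem t ht := (h t ht).1
  growth s _ t _ hst i := by
    have hdist := hy.dist_le_mul (w + ε * t) (w + ε * s)
    rw [Real.dist_eq, add_sub_add_left_eq_sub, ← mul_sub,
      abs_of_nonneg (mul_nonneg hε (sub_nonneg.2 hst)), ← mul_assoc] at hdist
    exact (le_abs_self _).trans ((dist_le_pi_dist _ _ i).trans hdist)
  lt_field t ht := (h t ht).2

lemma exists_closedBall_neg_lt_field (hU : IsOpen U)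
    (hf : ContinuousOn (Function.uncurry f) (U ×ˢ univ)) (hI : IsCompact I) {c₀ : Fin n → ℝ}
    (hc₀ : c₀ ∈ U) :
    ∃ M > 0, ∃ d > 0, ∀ c ∈ Metric.closedBall c₀ d, c ∈ U ∧ ∀ a ∈ I, ∀ i, -M < f c a i := by
  obtain ⟨d, hd, hsub⟩ := Metric.nhds_basis_closedBall.mem_iff.1 (hU.mem_nhds hc₀)
  obtain ⟨M, hM⟩ := ((isCompact_closedBall c₀ d).prod hI).exists_bound_of_continuousOn
    (hf.mono (prod_mono hsub (subset_univ _)))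
  refine ⟨|M| + 1, by positivity, d, hd, fun c hc => ⟨hsub hc, fun a ha i => ?_⟩⟩
  have hbound : |f c a i| ≤ M := (norm_le_pi_norm _ i).trans (hM (c, a) ⟨hc, ha⟩)
  linarith [neg_le_of_abs_le hbound, le_abs_self M]

lemma exists_short_time_lower_solution (hU : IsOpen U)
    (hf : ContinuousOn (Function.uncurry f) (U ×ˢ univ)) (hI : IsCompact I) {c₀ c : Fin n → ℝ}
    (hc₀ : c₀ ∈ U) (hc : StrongLT c c₀) :
    ∃ τ > 0, ∀ l : ℝ → ℝ, (∀ t, l t ∈ I) → ∀ t₀ t₁, t₁ - t₀ ≤ τ →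
      ∃ κ m, IsStrictLowerSolution U f l (Icc t₀ t₁) κ m ∧ m t₀ = c₀ ∧ StrongLT c (m t₁) := by
  obtain ⟨M, hM, d, hd, hball⟩ := exists_closedBall_neg_lt_field hU hf hI hc₀
  have hsmall : ∀ᶠ τ in 𝓝 (0 : ℝ), M * τ ≤ d ∧ ∀ i, c i < c₀ i - M * τ := by
    refine Eventually.and (Tendsto.eventually_le_const hd
      (Continuous.tendsto' (by fun_prop) _ _ (mul_zero M))) (eventually_all.2 fun i => ?_)
    exact Tendsto.eventually_const_lt (hc i) (Continuous.tendsto' (by fun_prop) _ _ (by simp))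
  obtain ⟨τ, hτ, hτd, hτc⟩ := hsmall.exists_gt
  refine ⟨τ, hτ, fun l hl t₀ t₁ ht =>
    ⟨-M, fun t i => c₀ i - M * (t - t₀), ?_, by simp, fun i => ?_⟩⟩
  · have hmem : ∀ t ∈ Icc t₀ t₁, (fun i => c₀ i - M * (t - t₀)) ∈ Metric.closedBall c₀ d := by
      intro t htt
      have hnonneg : 0 ≤ M * (t - t₀) := mul_nonneg hM.le (sub_nonneg.2 htt.1)
      have hle : M * (t - t₀) ≤ M * τ :=
        mul_le_mul_of_nonneg_left ((sub_le_sub_right htt.2 t₀).trans ht) hM.le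
      refine (dist_pi_le_iff hd.le).2 fun i => ?_
      rw [dist_comm, Real.dist_eq, sub_sub_cancel, abs_of_nonneg hnonneg]
      exact hle.trans hτd
    exact ⟨Continuous.continuousOn (by fun_prop), fun t ht => (hball _ (hmem t ht)).1,
      fun s _ t _ _ i => by linarith, fun t ht => (hball _ (hmem t ht)).2 _ (hl t)⟩
  · exact (hτc i).trans_le (sub_le_sub_left (mul_le_mul_of_nonneg_left ht hM.le) _)

lemma strongLT_of_lower_solutions (hf : IsCooperativeFamily U f I) (hl : ∀ t, l t ∈ I)
    {x y m z : ℝ → (Fin n → ℝ)} (hxU : ∀ t, x t ∈ U) (hx : ∀ t, HasDerivAt x (f (x t) (l t)) t)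
    {t₀ t₁ κ κ' κ'' : ℝ} (ht : t₀ ≤ t₁) (hy : IsStrictLowerSolution U f l (Iic t₀) κ y)
    (hyx : ∀ᶠ t in atBot, StrongLT (y t) (x t))
    (hm : IsStrictLowerSolution U f l (Icc t₀ t₁) κ' m) (hmy : m t₀ ≤ y t₀)
    (hz : IsStrictLowerSolution U f l (Ici t₁) κ'' z) (hzm : z t₁ ≤ m t₁) {t : ℝ}
    (htt : t₁ ≤ t) : StrongLT (z t) (x t) := by
  have compare : ∀ {a b κ y}, a ≤ b → IsStrictLowerSolution U f l (Icc a b) κ y →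
      StrongLT (y a) (x a) → StrongLT (y b) (x b) := fun hab hy ha =>
    hy.strongLT hf (fun t _ => hl t) (fun t _ => hxU t) (fun t _ => hx t) ha _ ⟨hab, le_rfl⟩
  obtain ⟨τ, hτ, hτt₀⟩ := (hyx.and (eventually_le_atBot t₀)).exists
  have hyx₀ : StrongLT (y t₀) (x t₀) := compare hτt₀ (hy.mono Icc_subset_Iic_self) hτ
  have hmx₁ : StrongLT (m t₁) (x t₁) := compare ht hm fun i => (hmy i).trans_lt (hyx₀ i)
  exact compare htt (hz.mono Icc_subset_Ici_self) fun i => (hzm i).trans_lt (hmx₁ i)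

theorem not_endpointTracks_of_lower_solutions (hf : IsCooperativeFamily U f I) {L : ℝ → ℝ}
    (hL : ∀ s, L s ∈ I) {r t₀ t₁ κ κ' κ'' : ℝ} {y m z : ℝ → (Fin n → ℝ)}
    {b c Xm Xp : Fin n → ℝ} (ht : t₀ ≤ t₁)
    (hy : IsStrictLowerSolution U f (fun t => L (r * t)) (Iic t₀) κ y)
    (hyb : ∀ᶠ t in atBot, y t = b) (hb : StrongLT b Xm)
    (hm : IsStrictLowerSolution U f (fun t => L (r * t)) (Icc t₀ t₁) κ' m) (hmy : m t₀ ≤ y t₀)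
    (hz : IsStrictLowerSolution U f (fun t => L (r * t)) (Ici t₁) κ'' z) (hzm : z t₁ ≤ m t₁)
    (hzc : ∀ᶠ t in atTop, z t = c) (hc : ¬ c ≤ Xp) : ¬ EndpointTracks U f L r Xm Xp := by
  rintro ⟨x, hx, hlim⟩
  have hyx : ∀ᶠ t in atBot, StrongLT (y t) (x t) := by
    filter_upwards [hyb, hx.tendsto_atBot.eventually (eventually_strongLT_right hb)] with t hyt hbt
    rwa [hyt]
  refine hc (ge_of_tendsto hlim ?_)
  filter_upwards [hzc, eventually_ge_atTop t₁] with t hzt htt i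
  rw [← hzt]
  exact (strongLT_of_lower_solutions hf (fun t => hL (r * t)) (fun t => hx.mem t (mem_univ t))
    (fun t => hx.hasDerivAt t (mem_univ t)) ht hy hyx hm hmy hz hzm htt i).le

variable {L : ℝ → ℝ} {Xm Xp b c : Fin n → ℝ}

theorem exists_jumpTime_not_endpointTracks (hf : IsCooperativeFamily U f I) (hI : IsCompact I)
    (hL : ∀ s, L s ∈ I) {u v : ℝ} {y z : ℝ → (Fin n → ℝ)} {K K' : ℝ≥0} {ρ ρ' : ℝ} (hρ : 0 < ρ)
    (hρ' : 0 < ρ') (hyK : LipschitzWith K y)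
    (hy : ∀ s ≤ u, y s ∈ U ∧ ∀ i, ρ < f (y s) (L s) i) (hyb : ∀ᶠ s in atBot, y s = b)
    (hb : StrongLT b Xm) (hzK : LipschitzWith K' z)
    (hz : ∀ s ≥ v, z s ∈ U ∧ ∀ i, ρ' < f (z s) (L s) i) (hzc : ∀ᶠ s in atTop, z s = c)
    (hc : ¬ c ≤ Xp) (hzy : StrongLT (z v) (y u)) :
    ∃ ε > 0, ∃ δ > 0, ¬ EndpointTracks U f (L ∘ jumpTime u v ε δ) 1 Xm Xp := by
  choose c' hzc' hcy' using fun i => exists_between (hzy i)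
  obtain ⟨δ, hδ, hlower⟩ := exists_short_time_lower_solution hf.isOpen hf.contDiffOn.continuousOn
    hI (hy u le_rfl).1 hcy'
  have hsmall : ∀ᶠ ε in 𝓝 (0 : ℝ), K * ε < ρ ∧ K' * ε < ρ' ∧ StrongLT (z (v + ε * δ)) c' := by
    refine (Tendsto.eventually_lt_const hρ (Continuous.tendsto' (by fun_prop) _ _ (by simp))).and
      ((Tendsto.eventually_lt_const hρ' (Continuous.tendsto' (by fun_prop) _ _ (by simp))).and ?_)
    have hcont : Continuous fun ε : ℝ => z (v + ε * δ) := hzK.continuous.comp (by fun_prop)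
    exact (hcont.tendsto' 0 (z v) (by simp)).eventually (eventually_strongLT_left hzc')
  obtain ⟨ε, hε, hKρ, hKρ', hzε⟩ := hsmall.exists_gt
  refine ⟨ε, hε, δ, hδ, ?_⟩
  obtain ⟨κ, m, hm, hm₀, hm₁⟩ := hlower (fun t => (L ∘ jumpTime u v ε δ) (1 * t))
    (fun t => hL _) 0 δ (by simp)
  refine not_endpointTracks_of_lower_solutions hf (fun s => hL _) hδ.le
    (y := fun t => y (u + ε * t)) (z := fun t => z (v + ε * t))
    (isStrictLowerSolution_of_lipschitzWith hyK hε.le fun t ht => ?_)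
    ((tendsto_atBot_add_const_left _ u (tendsto_id.const_mul_atBot hε)).eventually hyb) hb hm
    (by simp [hm₀])
    (isStrictLowerSolution_of_lipschitzWith hzK hε.le fun t ht => ?_)
    (fun i => ((hzε i).trans (hm₁ i)).le)
    ((tendsto_atTop_add_const_left _ v (tendsto_id.const_mul_atTop hε)).eventually hzc) hc
  · obtain ⟨hyU, hyf⟩ := hy (u + ε * t)
      (add_le_of_nonpos_right (mul_nonpos_of_nonneg_of_nonpos hε.le ht))
    refine ⟨hyU, fun i => hKρ.trans ?_⟩
    rw [one_mul, jumpTime_of_nonpos hδ ht]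
    exact hyf i
  · obtain ⟨hzU, hzf⟩ := hz (v + ε * t)
      (le_add_of_nonneg_right (mul_nonneg hε.le (hδ.le.trans ht)))
    refine ⟨hzU, fun i => hKρ'.trans ?_⟩
    rw [one_mul, jumpTime_of_le hδ ht]
    exact hzf i

lemma eventually_field_pos {F : Filter ℝ} {x : Fin n → ℝ} {l₀ : ℝ}
    (hU : IsOpen U) (hf : ContDiffOn ℝ 1 (Function.uncurry f) (U ×ˢ univ)) (hx : x ∈ U)
    (hL : Tendsto L F (𝓝 l₀)) (hpos : ∀ i, 0 < f x l₀ i) : ∀ᶠ s in F, ∀ i, 0 < f x (L s) i := by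
  have hlim : Tendsto (fun s => f x (L s)) F (𝓝 (f x l₀)) :=
    (contDiffAt_uncurry hU hf hx l₀).continuousAt.tendsto.comp
      (tendsto_const_nhds.prodMk_nhds hL)
  exact hlim.eventually (eventually_strongLT_right hpos)

theorem exists_rate_not_endpointTracks (hf : IsCooperativeFamily U f I) (hI : IsCompact I)
    (hL : ∀ s, L s ∈ I) (hbU : b ∈ U) (hcU : c ∈ U) (hbf : ∀ᶠ s in atBot, ∀ i, 0 < f b (L s) i)
    (hcf : ∀ᶠ s in atTop, ∀ i, 0 < f c (L s) i) (hb : StrongLT b Xm) (hc : ¬ c ≤ Xp)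
    (hcb : StrongLT c b) : ∃ r₀ > 0, ∀ r > r₀, ¬ EndpointTracks U f L r Xm Xp := by
  obtain ⟨s₀, hbf⟩ := eventually_atBot.1 hbf
  obtain ⟨s₁, hs₀₁, hcf⟩ := (atTop_basis' (s₀ + 1)).eventually_iff.1 hcf
  have hlt : s₀ < s₁ := (lt_add_one s₀).trans_le hs₀₁
  obtain ⟨τ, hτ, hlower⟩ := exists_short_time_lower_solution hf.isOpen hf.contDiffOn.continuousOn
    hI hbU hcb
  refine ⟨(s₁ - s₀) / τ, div_pos (sub_pos.2 hlt) hτ, fun r hr => ?_⟩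
  have hr₀ : 0 < r := (div_pos (sub_pos.2 hlt) hτ).trans hr
  have hduration : s₁ / r - s₀ / r ≤ τ := by
    rw [← sub_div]
    exact (div_le_comm₀ hτ hr₀).1 hr.le
  obtain ⟨κ, m, hm, hm₀, hm₁⟩ := hlower (fun t => L (r * t)) (fun t => hL _) _ _ hduration
  exact not_endpointTracks_of_lower_solutions hf hL (div_le_div_of_nonneg_right hlt.le hr₀.le)
    (isStrictLowerSolution_const hbU fun t ht => hbf _ ((le_div_iff₀' hr₀).1 ht))
    (Eventually.of_forall fun _ => rfl) hb hm hm₀.le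
    (isStrictLowerSolution_const hcU fun t ht => hcf ((div_le_iff₀' hr₀).1 ht))
    (fun i => (hm₁ i).le) (Eventually.of_forall fun _ => rfl) hc

end Tipping

section Directions

open scoped Matrix

variable {n : ℕ} {U : Set (Fin n → ℝ)} {f : (Fin n → ℝ) → ℝ → (Fin n → ℝ)} {x : Fin n → ℝ}
  {l : ℝ}

/-- The open cone of the vectors all of whose components are negative: the directions in which a
lower solution leaves an attracting equilibrium. -/
def negativeCone (n : ℕ) : ConvexCone ℝ (Fin n → ℝ) where
  carrier := {v | StrongLT v 0}
  smul_mem' _ hc _ hv i := mul_neg_of_pos_of_neg hc (hv i)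
  add_mem' _ hv _ hw i := add_neg (hv i) (hw i)

lemma isOpen_negativeCone : IsOpen (negativeCone n : Set (Fin n → ℝ)) :=
  isOpen_iff_eventually.2 fun _ hv => eventually_strongLT_left hv

lemma IsAttractingEquilibrium.hasIncreasingDirection
    (h : IsAttractingEquilibrium (fun x => f x l) x) (hmono : IsMonotoneSystem U fun x => f x l)
    (hx : x ∈ U) : HasIncreasingDirection U f (negativeCone n) (x, l) := by
  have hmetzler : IsMetzler (jacobian (fun x => f x l) x) := hmono x hx
  obtain ⟨w, hw, hAw⟩ := hmetzler.exists_pos_mulVec_neg h.2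
  refine ⟨hx, h.1, -w, fun i => neg_neg_of_pos (hw i), fun i => ?_⟩
  rw [Matrix.mulVec_neg]
  exact neg_pos_of_neg (hAw i)

lemma HasPositiveUnstableDirection.hasIncreasingDirection
    (h : HasPositiveUnstableDirection (fun x => f x l) x) (h₀ : f x l = 0) (hx : x ∈ U) :
    HasIncreasingDirection U f ⊤ (x, l) := by
  obtain ⟨μ, hμ, v, hv, hev⟩ := h
  refine ⟨hx, h₀, v, trivial, fun i => ?_⟩
  rw [← Matrix.toLin'_apply, hev.apply_eq_smul]
  exact mul_pos hμ (hv i)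

lemma HasPositiveUnstableDirection.not_le_of_strongLT {g : (Fin n → ℝ) → (Fin n → ℝ)}
    {y z : Fin n → ℝ} (h : HasPositiveUnstableDirection g x) (hyz : StrongLT y z) : ¬ z ≤ y := by
  obtain ⟨μ, -, v, -, hev⟩ := h
  obtain ⟨i, -⟩ := Function.ne_iff.1 hev.2
  exact fun hzy => (hyz i).not_ge (hzy i)

end Directions

section StableUnstablePaths

variable {n : ℕ} {U : Set (Fin n → ℝ)} {f : (Fin n → ℝ) → ℝ → (Fin n → ℝ)} {lm lp : ℝ} {L : ℝ → ℝ}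
  {q p : ℝ → (Fin n → ℝ)} {qm qp pm pp : Fin n → ℝ}

/-- A stable path `q` and a path `p` of equilibria with positive unstable directions, for a
parameter shift `L` of a cooperative family of systems. -/
structure IsStableUnstablePair (U : Set (Fin n → ℝ)) (f : (Fin n → ℝ) → ℝ → (Fin n → ℝ))
    (lm lp : ℝ) (L : ℝ → ℝ) (q : ℝ → (Fin n → ℝ)) (qm qp : Fin n → ℝ) (p : ℝ → (Fin n → ℝ))
    (pm pp : Fin n → ℝ) : Prop where
  family : IsCooperativeFamily U f (Icc lm lp)
  shift : IsParameterShift lm lp L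
  stable : IsStablePath U f L q qm qp
  attracting_left : IsAttractingEquilibrium (fun x => f x lm) qm
  path : IsPath U f L p pm pp
  unstable : ∀ s, HasPositiveUnstableDirection (fun x => f x (L s)) (p s)
  unstable_right : HasPositiveUnstableDirection (fun x => f x lp) pp

namespace IsStableUnstablePair

variable (h : IsStableUnstablePair U f lm lp L q qm qp p pm pp)
include h

lemma monotone_left : IsMonotoneSystem U fun x => f x lm :=
  h.family.monotone lm (left_mem_Icc.2 ((h.shift.mem_Icc 0).1.trans (h.shift.mem_Icc 0).2))

lemma apply_right_eq_zero : f pp lp = 0 := by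
  have hcont := (contDiffAt_uncurry h.family.isOpen h.family.contDiffOn h.path.limit_mem_right
    lp).continuousAt
  have hlim := hcont.tendsto.comp (h.path.tendsto_atTop.prodMk_nhds h.shift.tendsto_atTop)
  refine tendsto_nhds_unique hlim (tendsto_const_nhds.congr fun s => ?_)
  exact (h.path.equilibrium s).symm

lemma hasIncreasingDirection_stable (s : ℝ) :
    HasIncreasingDirection U f (negativeCone n) (q s, L s) :=
  (h.stable.attracting s).hasIncreasingDirection (h.family.monotone _ (h.shift.mem_Icc s))
    (h.stable.mem s)

lemma hasIncreasingDirection_stable_left :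
    HasIncreasingDirection U f (negativeCone n) (qm, lm) :=
  h.attracting_left.hasIncreasingDirection h.monotone_left h.stable.limit_mem_left

lemma hasIncreasingDirection_unstable (s : ℝ) : HasIncreasingDirection U f ⊤ (p s, L s) :=
  (h.unstable s).hasIncreasingDirection (h.path.equilibrium s) (h.path.mem s)

lemma hasIncreasingDirection_unstable_right : HasIncreasingDirection U f ⊤ (pp, lp) :=
  h.unstable_right.hasIncreasingDirection h.apply_right_eq_zero h.path.limit_mem_right

lemma hasPullbackAttractor {L' : ℝ → ℝ} (hL' : IsParameterShift lm lp L') {r : ℝ} (hr : 0 < r) :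
    HasPullbackAttractor U f L' r qm :=
  RTip.hasPullbackAttractor h.family.isOpen h.family.contDiffOn h.stable.limit_mem_left
    h.monotone_left h.attracting_left hL'.contDiff.continuous hL'.tendsto_atBot hr

theorem exists_reparametrization_rTipping {u v : ℝ} (huv : u ≤ v) (hpq : StrongLT (p v) (q u))
    (hpp : ¬ pp ≤ qp) :
    ∃ σ, IsReparametrization σ ∧ IsParameterShift lm lp (L ∘ σ) ∧
      ∃ r, 0 < r ∧ RTipping U f (L ∘ σ) r qm qp := by
  have hL := h.shift.contDiff.continuous
  obtain ⟨e', he', hz_close, hc_close⟩ :=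
    ((eventually_forall_displacedPoints (z := (p v, L v)) (eventually_strongLT_left hpq)).and
      (eventually_forall_displacedPoints (z := (pp, lp))
        (isClosed_Iic.isOpen_compl.mem_nhds hpp))).exists_gt
  obtain ⟨z, c, K', ρ', hρ', hzK, hz, hc, hzc⟩ := exists_lower_curve_atTop h.family.isOpen
    h.family.contDiffOn isOpen_univ (h.path.continuous.prodMk hL)
    (h.path.tendsto_atTop.prodMk_nhds h.shift.tendsto_atTop)
    (fun s _ => h.hasIncreasingDirection_unstable s) h.hasIncreasingDirection_unstable_right he'
  have hzq : StrongLT (z v) (q u) := hz_close _ _ (hz v le_rfl)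
  obtain ⟨e, he, hy_close⟩ := (eventually_forall_displacedPoints (z := (q u, L u))
    (eventually_strongLT_right hzq)).exists_gt
  obtain ⟨y, b, K, ρ, hρ, hyK, hy, hb, hyb⟩ := exists_lower_curve_atBot h.family.isOpen
    h.family.contDiffOn isOpen_negativeCone (h.stable.continuous.prodMk hL)
    (h.stable.tendsto_atBot.prodMk_nhds h.shift.tendsto_atBot)
    (fun s _ => h.hasIncreasingDirection_stable s) h.hasIncreasingDirection_stable_left he
  have hbq : StrongLT b qm := fun i => sub_neg.1 (hb.2.2.1 i)
  obtain ⟨ε, hε, δ, hδ, hnot⟩ := exists_jumpTime_not_endpointTracks h.family isCompact_Icc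
    h.shift.mem_Icc hρ hρ' hyK (fun s hs => ⟨(hy s hs).1, (hy s hs).2.2.2⟩) hyb hbq
    hzK (fun s hs => ⟨(hz s hs).1, (hz s hs).2.2.2⟩) hzc (hc_close _ _ hc)
    (hy_close _ _ (hy u le_rfl))
  have hshift := h.shift.comp_jumpTime huv hε hδ
  exact ⟨jumpTime u v ε δ, isReparametrization_jumpTime huv hε hδ, hshift, 1, one_pos,
    h.hasPullbackAttractor hshift one_pos, hnot⟩

theorem exists_rate_rTipping (hpq : StrongLT pp qm) (hpp : ¬ pp ≤ qp) :
    ∃ r₀, 0 < r₀ ∧ ∀ r, r₀ < r → RTipping U f L r qm qp := by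
  obtain ⟨e', he', hc_close⟩ := (eventually_forall_displacedPoints (z := (pp, lp))
    ((eventually_strongLT_left hpq).and (isClosed_Iic.isOpen_compl.mem_nhds hpp))).exists_gt
  obtain ⟨c, ρ', hρ', hc⟩ := exists_mem_displacedPoints h.family.isOpen h.family.contDiffOn
    isOpen_univ h.hasIncreasingDirection_unstable_right he'
  obtain ⟨hcq, hcp⟩ := hc_close _ _ hc
  obtain ⟨e, he, hb_close⟩ := (eventually_forall_displacedPoints (z := (qm, lm))
    (eventually_strongLT_right hcq)).exists_gt
  obtain ⟨b, ρ, hρ, hb⟩ := exists_mem_displacedPoints h.family.isOpen h.family.contDiffOn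
    isOpen_negativeCone h.hasIncreasingDirection_stable_left he
  have hbq : StrongLT b qm := fun i => sub_neg.1 (hb.2.2.1 i)
  have hbf := eventually_field_pos h.family.isOpen h.family.contDiffOn hb.1
    h.shift.tendsto_atBot fun i => hρ.trans (hb.2.2.2 i)
  have hcf := eventually_field_pos h.family.isOpen h.family.contDiffOn hc.1
    h.shift.tendsto_atTop fun i => hρ'.trans (hc.2.2.2 i)
  obtain ⟨r₀, hr₀, hnot⟩ := exists_rate_not_endpointTracks h.family isCompact_Icc h.shift.mem_Icc
    hb.1 hc.1 hbf hcf hbq hcp (hb_close _ _ hb)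
  exact ⟨r₀, hr₀, fun r hr => ⟨h.hasPullbackAttractor h.shift (hr₀.trans hr), hnot r hr⟩⟩

end IsStableUnstablePair

end StableUnstablePaths

section Reflection

open scoped Pointwise

variable {n : ℕ} {U : Set (Fin n → ℝ)} {f : (Fin n → ℝ) → ℝ → (Fin n → ℝ)} {I : Set ℝ}
  {L : ℝ → ℝ} {r : ℝ} {X : ℝ → (Fin n → ℝ)} {Xm Xp x y : Fin n → ℝ} {l : ℝ}

/-- The vector field obtained from `f` by the change of variables `x ↦ -x`, which preserves
cooperativity and reverses the order of `ℝⁿ`. -/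
def reflect (f : (Fin n → ℝ) → ℝ → (Fin n → ℝ)) (x : Fin n → ℝ) (l : ℝ) : Fin n → ℝ :=
  -f (-x) l

lemma jacobian_reflect (f : (Fin n → ℝ) → ℝ → (Fin n → ℝ)) (l : ℝ) (x : Fin n → ℝ) :
    jacobian (fun x => reflect f x l) x = jacobian (fun x => f x l) (-x) := by
  have hderiv : fderiv ℝ (fun x => reflect f x l) x = fderiv ℝ (fun x => f x l) (-x) := by
    ext v i
    have hcomp : fderiv ℝ (fun x => f (-x) l) x = _ :=
      (ContinuousLinearEquiv.neg ℝ (M := Fin n → ℝ)).comp_right_fderiv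
        (f := fun x => f x l) (x := x)
    simp [reflect, fderiv_fun_neg, hcomp]
  ext i j
  simp only [jacobian, hderiv]

lemma strongLT_neg (h : StrongLT x y) : StrongLT (-y) (-x) := fun i => neg_lt_neg (h i)

lemma PConvex.neg (h : PConvex U) : PConvex (-U) := by
  rintro x hx y hy hxy _ ⟨a, b, ha, hb, hab, rfl⟩
  refine h (-y) hy (-x) hx (neg_le_neg hxy) ⟨b, a, hb, ha, (add_comm b a).trans hab, ?_⟩
  module

lemma IsCooperativeFamily.reflect (h : IsCooperativeFamily U f I) :
    IsCooperativeFamily (-U) (reflect f) I where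
  isOpen := h.isOpen.neg
  pconvex := h.pconvex.neg
  contDiffOn := by
    have hneg : ContDiff ℝ 1 fun z : (Fin n → ℝ) × ℝ => (-z.1, z.2) := by fun_prop
    exact (h.contDiffOn.comp hneg.contDiffOn fun z hz => ⟨hz.1, mem_univ _⟩).neg
  monotone l hl x hx i j hij := by
    rw [jacobian_reflect]
    exact h.monotone l hl (-x) hx i j hij

lemma IsAttractingEquilibrium.reflect (h : IsAttractingEquilibrium (fun x => f x l) x) :
    IsAttractingEquilibrium (fun x => reflect f x l) (-x) := by
  rw [IsAttractingEquilibrium, jacobian_reflect, RTip.reflect, neg_neg, neg_eq_zero]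
  exact h

lemma HasPositiveUnstableDirection.reflect
    (h : HasPositiveUnstableDirection (fun x => f x l) x) :
    HasPositiveUnstableDirection (fun x => reflect f x l) (-x) := by
  rw [HasPositiveUnstableDirection, jacobian_reflect, neg_neg]
  exact h

lemma IsPath.reflect (h : IsPath U f L X Xm Xp) :
    IsPath (-U) (reflect f) L (fun s => -X s) (-Xm) (-Xp) where
  continuous := h.continuous.neg
  mem s := neg_mem_neg.2 (h.mem s)
  equilibrium s := by rw [RTip.reflect, neg_neg, h.equilibrium s, neg_zero]
  limit_mem_left := neg_mem_neg.2 h.limit_mem_left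
  limit_mem_right := neg_mem_neg.2 h.limit_mem_right
  tendsto_atBot := h.tendsto_atBot.neg
  tendsto_atTop := h.tendsto_atTop.neg

lemma IsPullbackTrajectory.reflect {J : Set ℝ} (h : IsPullbackTrajectory U f L r Xm J X) :
    IsPullbackTrajectory (-U) (reflect f) L r (-Xm) J fun t => -X t where
  mem t ht := neg_mem_neg.2 (h.mem t ht)
  hasDerivAt t ht := by
    rw [RTip.reflect, neg_neg]
    exact (h.hasDerivAt t ht).fun_neg
  tendsto_atBot := h.tendsto_atBot.neg

lemma EndpointTracks.reflect (h : EndpointTracks U f L r Xm Xp) :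
    EndpointTracks (-U) (reflect f) L r (-Xm) (-Xp) := by
  obtain ⟨x, hx, hlim⟩ := h
  exact ⟨fun t => -x t, hx.reflect, hlim.neg⟩

lemma IsStableUnstablePair.reflect {lm lp : ℝ} {q p : ℝ → (Fin n → ℝ)} {qm qp pm pp : Fin n → ℝ}
    (h : IsStableUnstablePair U f lm lp L q qm qp p pm pp) :
    IsStableUnstablePair (-U) (reflect f) lm lp L (fun s => -q s) (-qm) (-qp) (fun s => -p s)
      (-pm) (-pp) where
  family := h.family.reflect
  shift := h.shift
  stable :=
    { h.stable.toIsPath.reflect with attracting := fun s => (h.stable.attracting s).reflect }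
  attracting_left := h.attracting_left.reflect
  path := h.path.reflect
  unstable s := (h.unstable s).reflect
  unstable_right := h.unstable_right.reflect

lemma IsStableUnstablePair.rTipping_of_reflect {lm lp : ℝ} {L' : ℝ → ℝ} {q p : ℝ → (Fin n → ℝ)}
    {qm qp pm pp : Fin n → ℝ} (h : IsStableUnstablePair U f lm lp L q qm qp p pm pp)
    (hL' : IsParameterShift lm lp L') (hr : 0 < r)
    (hreflect : RTipping (-U) (RTip.reflect f) L' r (-qm) (-qp)) : RTipping U f L' r qm qp :=
  ⟨h.hasPullbackAttractor hL' hr, fun htracks => hreflect.2 htracks.reflect⟩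

end Reflection

end RTip

theorem proposition5p4_general {n : ℕ} (U : Set (Fin n → ℝ)) (hU : IsOpen U) (hUc : RTip.PConvex U)
    (f : (Fin n → ℝ) → ℝ → (Fin n → ℝ))
    (hf : ContDiffOn ℝ 1 (fun z : (Fin n → ℝ) × ℝ => f z.1 z.2) (U ×ˢ Set.univ))
    (lm lp : ℝ) (L : ℝ → ℝ) (hL : RTip.IsParameterShift lm lp L)
    (hmono : ∀ l ∈ Set.Icc lm lp, RTip.IsMonotoneSystem U (fun x => f x l))
    (p : ℝ → (Fin n → ℝ)) (pm pp : Fin n → ℝ) (hp : RTip.IsPath U f L p pm pp)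
    (q : ℝ → (Fin n → ℝ)) (qm qp : Fin n → ℝ) (hq : RTip.IsStablePath U f L q qm qp)
    (hqm : RTip.IsAttractingEquilibrium (fun x => f x lm) qm)
    (hev : ∀ s, RTip.HasPositiveUnstableDirection (fun x => f x (L s)) (p s))
    (hevp : RTip.HasPositiveUnstableDirection (fun x => f x lp) pp) :
    (¬ pp ≤ qp →
      ((∃ u v : ℝ, u < v ∧ StrongLT (p v) (q u)) →
        ∃ σ : ℝ → ℝ, RTip.IsReparametrization σ ∧ RTip.IsParameterShift lm lp (L ∘ σ) ∧
          ∃ r : ℝ, 0 < r ∧ RTip.RTipping U f (L ∘ σ) r qm qp) ∧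
      (StrongLT pp qm →
        ∃ r₀ : ℝ, 0 < r₀ ∧ ∀ r : ℝ, r₀ < r → RTip.RTipping U f L r qm qp)) ∧
    (¬ qp ≤ pp →
      ((∃ u v : ℝ, u < v ∧ StrongLT (q u) (p v)) →
        ∃ σ : ℝ → ℝ, RTip.IsReparametrization σ ∧ RTip.IsParameterShift lm lp (L ∘ σ) ∧
          ∃ r : ℝ, 0 < r ∧ RTip.RTipping U f (L ∘ σ) r qm qp) ∧
      (StrongLT qm pp →
        ∃ r₀ : ℝ, 0 < r₀ ∧ ∀ r : ℝ, r₀ < r → RTip.RTipping U f L r qm qp)) := by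
  have h : RTip.IsStableUnstablePair U f lm lp L q qm qp p pm pp :=
    ⟨⟨hU, hUc, hf, hmono⟩, hL, hq, hqm, hp, hev, hevp⟩
  refine ⟨fun hpp => ⟨?_, fun hpq => h.exists_rate_rTipping hpq hpp⟩,
    fun hqp => ⟨?_, fun hqpp => ?_⟩⟩
  · rintro ⟨u, v, huv, hpq⟩
    exact h.exists_reparametrization_rTipping huv.le hpq hpp
  · rintro ⟨u, v, huv, hqupv⟩
    obtain ⟨σ, hσ, hLσ, r, hr, htip⟩ := h.reflect.exists_reparametrization_rTipping huv.le
      (RTip.strongLT_neg hqupv) (mt neg_le_neg_iff.1 hqp)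
    exact ⟨σ, hσ, hLσ, r, hr, h.rTipping_of_reflect hLσ hr htip⟩
  · obtain ⟨r₀, hr₀, htip⟩ := h.reflect.exists_rate_rTipping (RTip.strongLT_neg hqpp)
      (mt neg_le_neg_iff.1 hqp)
    exact ⟨r₀, hr₀, fun r hr => h.rTipping_of_reflect hL (hr₀.trans hr) (htip r hr)⟩

theorem proposition5p4 {n : ℕ} (U : Set (Fin n → ℝ)) (hU : IsOpen U) (hUc : RTip.PConvex U)
    (f : (Fin n → ℝ) → ℝ → (Fin n → ℝ))
    (hf : ContDiffOn ℝ 2 (fun z : (Fin n → ℝ) × ℝ => f z.1 z.2) (U ×ˢ Set.univ))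
    (lm lp : ℝ) (L : ℝ → ℝ) (hL : RTip.IsParameterShift lm lp L)
    (hmono : ∀ l ∈ Set.Icc lm lp, RTip.IsMonotoneSystem U (fun x => f x l))
    (p : ℝ → (Fin n → ℝ)) (pm pp : Fin n → ℝ) (hp : RTip.IsPath U f L p pm pp)
    (q : ℝ → (Fin n → ℝ)) (qm qp : Fin n → ℝ) (hq : RTip.IsStablePath U f L q qm qp)
    (hqm : RTip.IsAttractingEquilibrium (fun x => f x lm) qm)
    (hev : ∀ s, RTip.HasPositiveUnstableDirection (fun x => f x (L s)) (p s))
    (hevm : RTip.HasPositiveUnstableDirection (fun x => f x lm) pm)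
    (hevp : RTip.HasPositiveUnstableDirection (fun x => f x lp) pp) :
    (((∀ s, StrongLT (q s) (p s)) ∧ StrongLT qm pm ∧ StrongLT qp pp) →
      ((∃ u v : ℝ, u < v ∧ StrongLT (p v) (q u)) →
        ∃ σ : ℝ → ℝ, RTip.IsReparametrization σ ∧ RTip.IsParameterShift lm lp (L ∘ σ) ∧
          ∃ r : ℝ, 0 < r ∧ RTip.RTipping U f (L ∘ σ) r qm qp) ∧
      (StrongLT pp qm →
        ∃ r₀ : ℝ, 0 < r₀ ∧ ∀ r : ℝ, r₀ < r → RTip.RTipping U f L r qm qp)) ∧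
    (((∀ s, StrongLT (p s) (q s)) ∧ StrongLT pm qm ∧ StrongLT pp qp) →
      ((∃ u v : ℝ, u < v ∧ StrongLT (q u) (p v)) →
        ∃ σ : ℝ → ℝ, RTip.IsReparametrization σ ∧ RTip.IsParameterShift lm lp (L ∘ σ) ∧
          ∃ r : ℝ, 0 < r ∧ RTip.RTipping U f (L ∘ σ) r qm qp) ∧
      (StrongLT qm pp →
        ∃ r₀ : ℝ, 0 < r₀ ∧ ∀ r : ℝ, r₀ < r → RTip.RTipping U f L r qm qp)) := by
  have h := proposition5p4_general U hU hUc f (hf.of_le one_le_two) lm lp L hL hmono p pm pp hp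
    q qm qp hq hqm hev hevp
  exact ⟨fun hqp => h.1 (hevp.not_le_of_strongLT hqp.2.2),
    fun hpq => h.2 (hevp.not_le_of_strongLT hpq.2.2)⟩
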